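/- Let $X(n)=(X_1(n),X_2(n))$, $n\ge 1$, be independent, identically distributed random variables with values in $\mathbb R^2$, let $X=(X_1,X_2)$ have their common distribution, and put $S(0)=0$, $S(n)=(S_1(n),S_2(n))=X(1)+\dots+X(n)$. Let $Q=(0,\infty)^2$ be the open quadrant and assume $\mathbb P[X\in Q]>0$. Assume that for some $\delta>0$ $$\mathbb E\bigl(|X_i|^{2+\delta}\bigr)<\infty\ (i=1,2),\qquad \mathbb E(X_1)=0,\qquad \mathbb E(X_2)>0,\qquad \mathbb E\bigl((X_2^-)^{3+\delta}\bigr)<\infty,$$ where $X_2^-=\max\{-X_2,0\}$. For $x=(x_1,x_2)\in Q$ and $t>0$ let $$\tau_x=\inf\{n\ge 1: x+S(n)\notin Q\},\qquad \tau_{1,t}=\inf\{n\ge 1: t+S_1(n)\le 0\}$$ (with $\inf\emptyset=\infty$), and define $$h(x)=x_1-\mathbb E\bigl(x_1+S_1(\tau_x)\,;\,\tau_x<\infty\bigr),\qquad h_1(t)=t-\mathbb E\bigl(t+S_1(\tau_{1,t})\,;\,\tau_{1,t}<\infty\bigr).$$ Then the expectations defining $h$ on $Q$ and $h_1$ on $(0,\infty)$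 are finite (that is, the random variables in them are integrable), and: 1. $h(x)>0$ for every $x\in Q$, and $h$ is harmonic for the random walk killed when exiting $Q$, that is, for every $x\in Q$, $h(x+S(1))$ is integrable on $\{\tau_x>1\}$ and $h(x)=\mathbb E\bigl(h(x+S(1))\,;\,\tau_x>1\bigr)$. 2. $h(x)\le h_1(x_1)$ for every $x\in Q$. 3. $h(x)/h_1(x_1)\to 1$ as $x_2\to\infty$, uniformly for $0<x_1\le x_2^{2+\delta}$: for every $\varepsilon>0$ there is $b>0$ such that $|h(x)/h_1(x_1)-1|<\varepsilon$ whenever $x_2\ge b$ and $0<x_1\le x_2^{2+\delta}$. -/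

import Mathlib

open MeasureTheory ProbabilityTheory

/-- The open positive quadrant of the plane. -/
def openQuadrant : Set (ℝ × ℝ) := {x | 0 < x.1 ∧ 0 < x.2}

/-- The random walk `x + S(n)` started at `x`, where `S(n)` is the sum of the first `n` increments.
The increments are indexed from `0`: the first one is `X 0`. -/
def walkFrom {Ω E : Type*} [AddCommMonoid E] (X : ℕ → Ω → E) (x : E) (n : ℕ) (ω : Ω) : E :=
  x + ∑ k ∈ Finset.range n, X k ω

/-- The exit time `inf {n ≥ 1 : x + S(n) ∉ D}` of the walk from the set `D`
(equal to `⊤` if the walk never leaves `D`). -/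
noncomputable def exitTime {Ω E : Type*} [AddCommMonoid E] (X : ℕ → Ω → E) (D : Set E) (x : E) :
    Ω → WithTop ℕ :=
  hittingAfter (walkFrom X x) Dᶜ 1

/-- The position `x + S(τ_x)` of the walk at its exit time from `D`; it is only meaningful, and only
used below, on the event that the exit time is finite. -/
noncomputable def exitPosition {Ω E : Type*} [AddCommMonoid E] (X : ℕ → Ω → E) (D : Set E) (x : E) :
    Ω → E :=
  stoppedValue (walkFrom X x) (exitTime X D x)

/-- The event `τ_x < ∞`. -/
def exitEvent {Ω E : Type*} [AddCommMonoid E] (X : ℕ → Ω → E) (D : Set E) (x : E) : Set Ω :=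
  {ω | exitTime X D x ω < ⊤}

/-- A real function `h` is harmonic on `D` for the walk killed when exiting `D`: for every `x` in
`D`, `h(x + S(1))` is integrable on the event `τ_x > 1`, and its expectation there is `h(x)`. -/
def IsHarmonicKilled {Ω E : Type*} [MeasurableSpace Ω] [AddCommMonoid E] (P : Measure Ω)
    (X : ℕ → Ω → E) (D : Set E) (h : E → ℝ) : Prop :=
  ∀ x ∈ D,
    IntegrableOn (fun ω => h (walkFrom X x 1 ω)) {ω | 1 < exitTime X D x ω} P ∧
    h x = ∫ ω in {ω | 1 < exitTime X D x ω}, h (walkFrom X x 1 ω) ∂P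

/-- The one-dimensional function `h₁(t) = t - E(t + S(τ_t) ; τ_t < ∞)`, where `τ_t` is the exit
time from the open half-line. -/
noncomputable def halfLineFun {Ω : Type*} [MeasurableSpace Ω] (P : Measure Ω)
    (Y : ℕ → Ω → ℝ) (t : ℝ) : ℝ :=
  t - ∫ ω in exitEvent Y (Set.Ioi 0) t, exitPosition Y (Set.Ioi 0) t ω ∂P

/-- The function `h(x) = x₁ - E(x₁ + S₁(τ_x) ; τ_x < ∞)`, where `τ_x` is the exit time from the
open quadrant. -/
noncomputable def quadrantFun {Ω : Type*} [MeasurableSpace Ω] (P : Measure Ω)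
    (X : ℕ → Ω → ℝ × ℝ) (x : ℝ × ℝ) : ℝ :=
  x.1 - ∫ ω in exitEvent X openQuadrant x, (exitPosition X openQuadrant x ω).1 ∂P

/-! Both functions are limits of killed means. For a domain in the right half-plane, stopping the
martingale x₁ + S₁(n) at the exit time τ gives E(x₁ + S₁(n); τ > n) = x₁ - E(x₁ + S₁(τ); τ ≤ n).
Letting n → ∞ requires control of the exit position. This comes from `exists_superharmonic`: a
function V with |y| ≤ V(y) ≤ C(1 + |y|) whose mean does not increase in a step from y > 0. Stopping
V bounds E(|x₁ + S₁(τ)|; τ < ∞) by V(x₁), whence `tendsto_killedMean_fst`. Killed means are powers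
of the one-step operator and are dominated by V, so the limit is harmonic. The half-plane yields h₁
and the quadrant h, and comparing killed means gives h ≤ h₁.

For the ratio, the difference h₁ - h is caused by paths that leave the quadrant at some time k while
staying in the half-plane, an event E_k. After that time V decreases on average, so h₁ - h ≤ ∑
E(V(x₁ + S₁(k)); E_k) (`killedMean_sub_le`). On E_k one has S₂(k) ≤ -x₂. This has probability
O(k^{-(2+δ)}) by `exists_measure_sum_nonpos_le`, and for fixed k it becomes unlikely as x₂ → ∞. In
the linear bound for V the displacement s = S₁(k) is split as |s| ≤ w_k/θ + θ s²/w_k with w_k of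
order k^{1+δ/2}. The first part is summable against the probabilities. The second sums to O(θ),
because the second moment of the surviving walk grows by at most a constant per step and the E_k
remove disjoint pieces of it. With θ small and then x₂ large, h₁ - h is a small multiple of 1 + x₁,
while h₁ ≥ c(1 + x₁).

Finally, the ratio makes h positive for large x₂, and harmonicity together with steps into the
quadrant carries positivity down to every starting point. -/

open Filter
open scoped Topology ENNReal

/-! ### Exit times expressed through survival events -/

section Exit

variable {Ω E : Type*} [AddCommMonoid E] {X : ℕ → Ω → E} {D : Set E} {x : E} {n : ℕ} {ω : Ω}

/-- The event that the walk started at `x` stays in `D` at the times `1, …, n`. -/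
def survivalSet (X : ℕ → Ω → E) (D : Set E) (x : E) (n : ℕ) : Set Ω :=
  {ω | ∀ k, 1 ≤ k → k ≤ n → walkFrom X x k ω ∈ D}

lemma walkFrom_zero : walkFrom X x 0 ω = x := by simp [walkFrom]

lemma walkFrom_one : walkFrom X x 1 ω = x + X 0 ω := by simp [walkFrom]

lemma walkFrom_succ : walkFrom X x (n + 1) ω = walkFrom X x n ω + X n ω := by
  simp [walkFrom, Finset.sum_range_succ, add_assoc]

lemma survivalSet_zero : survivalSet X D x 0 = Set.univ := by
  ext ω
  simp only [survivalSet, Set.mem_ofPred_eq, Set.mem_univ, iff_true]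
  intro k h1 h2
  omega

lemma mem_survivalSet_succ :
    ω ∈ survivalSet X D x (n + 1) ↔ ω ∈ survivalSet X D x n ∧ walkFrom X x (n + 1) ω ∈ D := by
  refine ⟨fun h => ⟨fun k h1 h2 => h k h1 (by omega), h _ (by omega) le_rfl⟩, ?_⟩
  rintro ⟨h, h'⟩ k h1 h2
  rcases Nat.lt_or_ge n k with hk | hk
  · obtain rfl : k = n + 1 := by omega
    exact h'
  · exact h k h1 hk

lemma survivalSet_antitone : Antitone (survivalSet X D x) :=
  antitone_nat_of_succ_le fun _ _ h => (mem_survivalSet_succ.1 h).1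

lemma survivalSet_mono {D' : Set E} (h : D ⊆ D') : survivalSet X D x n ⊆ survivalSet X D' x n :=
  fun _ hω k h1 h2 => h (hω k h1 h2)

lemma walkFrom_mem_of_survival (hx : x ∈ D) (h : ω ∈ survivalSet X D x n) :
    walkFrom X x n ω ∈ D := by
  rcases Nat.eq_zero_or_pos n with rfl | hn
  · simpa [walkFrom_zero] using hx
  · exact h n hn le_rfl

/-- The bridge from the random time to events determined by finitely many increments. -/
lemma lt_exitTime_iff : (n : WithTop ℕ) < exitTime X D x ω ↔ ω ∈ survivalSet X D x n := by
  rw [← not_iff_not, not_lt, exitTime]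
  change hittingAfter _ _ _ _ ≤ WithTop.some n ↔ _
  rw [hittingAfter_le_iff]
  simp [survivalSet, and_assoc]

lemma exitEvent_eq : exitEvent X D x = ⋃ n, (survivalSet X D x n)ᶜ := by
  ext ω
  simp only [exitEvent, Set.mem_ofPred_eq, Set.mem_iUnion, Set.mem_compl_iff, ← lt_exitTime_iff,
    not_lt]
  constructor
  · intro h
    lift exitTime X D x ω to ℕ using h.ne with m
    exact ⟨m, le_rfl⟩
  · rintro ⟨n, hn⟩
    exact hn.trans_lt (WithTop.coe_lt_top n)

lemma exitPosition_eq (h : ω ∈ survivalSet X D x n \ survivalSet X D x (n + 1)) :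
    exitPosition X D x ω = walkFrom X x (n + 1) ω := by
  have h1 := lt_exitTime_iff.2 h.1
  have h2 := not_lt.1 (mt lt_exitTime_iff.1 h.2)
  have h3 : exitTime X D x ω = WithTop.some (n + 1) := by
    lift exitTime X D x ω to ℕ using ne_top_of_le_ne_top (WithTop.coe_ne_top) h2 with m
    have h1' : n < m := WithTop.coe_lt_coe.1 h1
    have h2' : m ≤ n + 1 := WithTop.coe_le_coe.1 h2
    rw [Nat.le_antisymm h2' h1']
  rw [exitPosition, stoppedValue, h3]
  -- The time is finite here, so the default value used at `⊤` plays no role.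
  exact congrArg (fun k => walkFrom X x k ω) (WithTop.untopD_coe _ (n + 1))

lemma walkFrom_fst {X : ℕ → Ω → ℝ × ℝ} {x : ℝ × ℝ} :
    (walkFrom X x n ω).1 = x.1 + ∑ k ∈ Finset.range n, (X k ω).1 := by
  simp [walkFrom, Prod.fst_sum]

lemma walkFrom_snd {X : ℕ → Ω → ℝ × ℝ} {x : ℝ × ℝ} :
    (walkFrom X x n ω).2 = x.2 + ∑ k ∈ Finset.range n, (X k ω).2 := by
  simp [walkFrom, Prod.snd_sum]

lemma survivalSet_compl_succ : (survivalSet X D x (n + 1))ᶜ =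
    (survivalSet X D x n)ᶜ ∪ (survivalSet X D x n \ survivalSet X D x (n + 1)) := by
  ext ω
  have := @survivalSet_antitone Ω E _ X D x n (n + 1) (Nat.le_succ n) ω
  simp only [Set.mem_compl_iff, Set.mem_union, Set.mem_sdiff]
  tauto

lemma disjoint_survival_compl_sdiff : Disjoint (survivalSet X D x n)ᶜ
    (survivalSet X D x n \ survivalSet X D x (n + 1)) :=
  Set.disjoint_left.2 fun _ h h' => h h'.1

end Exit

/-! ### Filtration of the increments and independence -/

section Past

variable {Ω E : Type*} [MeasurableSpace E] {X : ℕ → Ω → E} {n : ℕ}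

/-- The `σ`-algebra generated by the first `n` increments. -/
abbrev pastAlgebra (X : ℕ → Ω → E) (n : ℕ) : MeasurableSpace Ω :=
  ⨆ k ∈ Set.Iio n, MeasurableSpace.comap (X k) inferInstance

lemma pastAlgebra_mono : Monotone (pastAlgebra X) := fun _ _ h =>
  biSup_mono fun _ hk => lt_of_lt_of_le hk h

lemma pastAlgebra_le [m : MeasurableSpace Ω] (hX : ∀ n, Measurable (X n)) :
    pastAlgebra X n ≤ m :=
  iSup₂_le fun k _ => (hX k).comap_le

lemma measurable_increment_past {k : ℕ} (hk : k < n) : Measurable[pastAlgebra X n] (X k) := by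
  have h : MeasurableSpace.comap (X k) inferInstance ≤ pastAlgebra X n :=
    le_iSup₂_of_le k hk le_rfl
  exact (comap_measurable (X k)).mono h le_rfl

lemma measurable_walkFrom_past [AddCommMonoid E] [MeasurableAdd₂ E] (x : E) :
    Measurable[pastAlgebra X n] (walkFrom X x n) := by
  unfold walkFrom
  refine Measurable.const_add (m := pastAlgebra X n) ?_ x
  exact Finset.measurable_fun_sum (m := pastAlgebra X n) _ fun k hk =>
    measurable_increment_past (Finset.mem_range.1 hk)

lemma measurableSet_survivalSet_past [AddCommMonoid E] [MeasurableAdd₂ E] (x : E) {D : Set E}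
    (hD : MeasurableSet D) : MeasurableSet[pastAlgebra X n] (survivalSet X D x n) := by
  have : survivalSet X D x n = ⋂ k ∈ Finset.Icc 1 n, walkFrom X x k ⁻¹' D := by
    ext ω; simp [survivalSet]
  rw [this]
  refine Finset.measurableSet_biInter (m := pastAlgebra X n) _ fun k hk => ?_
  exact pastAlgebra_mono (Finset.mem_Icc.1 hk).2 _ (measurable_walkFrom_past x hD)

lemma indepFun_of_past [MeasurableSpace Ω] {P : Measure Ω} (hX : ∀ n, Measurable (X n))
    (hindep : iIndepFun X P) {β : Type*} [MeasurableSpace β] {Z : Ω → β}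
    (hZ : Measurable[pastAlgebra X n] Z) : IndepFun Z (X n) P := by
  have h := indep_iSup_of_disjoint (fun k => (hX k).comap_le) hindep
    (S := Set.Iio n) (T := {n}) (by simp)
  rw [iSup_singleton] at h
  rw [IndepFun_iff_Indep]
  exact indep_of_indep_of_le_left h hZ.comap_le

end Past

/-! ### Markov property for one step -/

section MarkovStep

variable {Ω E : Type*} [MeasurableSpace Ω] [MeasurableSpace E] [AddCommMonoid E]
  [MeasurableAdd₂ E] {P : Measure Ω} [IsProbabilityMeasure P] {X : ℕ → Ω → E} {n : ℕ} {x : E}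

lemma measurable_walkFrom (hX : ∀ n, Measurable (X n)) : Measurable (walkFrom X x n) :=
  (measurable_walkFrom_past x).mono (pastAlgebra_le hX) le_rfl

lemma measurableSet_survivalSet (hX : ∀ n, Measurable (X n)) {D : Set E} (hD : MeasurableSet D) :
    MeasurableSet (survivalSet X D x n) :=
  pastAlgebra_le hX _ (measurableSet_survivalSet_past x hD)

/-- One step of the walk, averaged over the last increment, on an event of the past. -/
lemma setIntegral_walkFrom_succ (hX : ∀ n, Measurable (X n)) (hindep : iIndepFun X P)
    (hident : ∀ n, IdentDistrib (X n) (X 0) P P) {f : E → ℝ} (hf : Measurable f)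
    (hint : Integrable (fun ω => f (walkFrom X x (n + 1) ω)) P) {A : Set Ω}
    (hA : MeasurableSet[pastAlgebra X n] A) :
    IntegrableOn (fun ω => ∫ z, f (walkFrom X x n ω + z) ∂(P.map (X 0))) A P ∧
    ∫ ω in A, f (walkFrom X x (n + 1) ω) ∂P =
      ∫ ω in A, ∫ z, f (walkFrom X x n ω + z) ∂(P.map (X 0)) ∂P := by
  have hA' := pastAlgebra_le hX _ hA
  -- Carrying the indicator of the event as a coordinate makes the pair a single variable of the
  -- past, independent of the next increment; Fubini then does the rest.
  set Z : Ω → ℝ × E := fun ω => (A.indicator (fun _ => (1 : ℝ)) ω, walkFrom X x n ω) with hZdef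
  have hZ : Measurable[pastAlgebra X n] Z :=
    Measurable.prodMk (m := pastAlgebra X n)
      (Measurable.indicator (m := pastAlgebra X n) measurable_const hA)
      (measurable_walkFrom_past x)
  have hZ' : Measurable Z := hZ.mono (pastAlgebra_le hX) le_rfl
  have hmap : P.map (fun ω => (Z ω, X n ω)) = (P.map Z).prod (P.map (X 0)) := by
    rw [← (hident n).map_eq]
    exact (indepFun_iff_map_prod_eq_prod_map_map hZ'.aemeasurable
      (hX n).aemeasurable).1 (indepFun_of_past hX hindep hZ)
  have : IsProbabilityMeasure (P.map (X 0)) :=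
    Measure.isProbabilityMeasure_map (hX 0).aemeasurable
  have : IsProbabilityMeasure (P.map Z) :=
    Measure.isProbabilityMeasure_map hZ'.aemeasurable
  set g : (ℝ × E) × E → ℝ := fun p => p.1.1 * f (p.1.2 + p.2) with hg
  have hgm : Measurable g := by fun_prop
  have hgZ : ∀ ω, g (Z ω, X n ω) = A.indicator (fun ω => f (walkFrom X x (n + 1) ω)) ω := by
    intro ω
    by_cases h : ω ∈ A <;> simp [g, Z, h, walkFrom_succ]
  have hgi : Integrable g ((P.map Z).prod (P.map (X 0))) := by
    rw [← hmap, integrable_map_measure hgm.aestronglyMeasurable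
      (hZ'.prodMk (hX n)).aemeasurable]
    refine (hint.indicator hA').congr (Eventually.of_forall fun ω => ?_)
    simp [hgZ]
  have hin : ∀ ω, ∫ z, g (Z ω, z) ∂(P.map (X 0)) =
      A.indicator (fun ω => ∫ z, f (walkFrom X x n ω + z) ∂(P.map (X 0))) ω := by
    intro ω
    by_cases h : ω ∈ A <;> simp [g, Z, h]
  have hleft := hgi.integral_prod_left
  constructor
  · rw [integrable_map_measure hleft.aestronglyMeasurable hZ'.aemeasurable] at hleft
    rw [← integrable_indicator_iff hA']
    exact hleft.congr (Eventually.of_forall fun ω => hin ω)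
  · rw [← integral_indicator hA', ← integral_indicator hA']
    calc _ = ∫ ω, g (Z ω, X n ω) ∂P := by simp only [hgZ]
      _ = ∫ p, g p ∂(P.map (fun ω => (Z ω, X n ω))) := by
          rw [integral_map (hZ'.prodMk (hX n)).aemeasurable hgm.aestronglyMeasurable]
      _ = ∫ a, ∫ z, g (a, z) ∂(P.map (X 0)) ∂(P.map Z) := by
          rw [hmap, integral_prod _ hgi]
      _ = ∫ ω, ∫ z, g (Z ω, z) ∂(P.map (X 0)) ∂P := by
          rw [integral_map hZ'.aemeasurable hgi.integral_prod_left.aestronglyMeasurable]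
      _ = _ := by simp only [hin]

end MarkovStep

/-! ### A superharmonic majorant of linear growth in dimension one -/

section Lyapunov

variable {ν : Measure ℝ}

lemma memLp_id_of_integrable_rpow {q : ℝ} (hq : 0 < q)
    (hmom : Integrable (fun z : ℝ => |z| ^ q) ν) : MemLp (fun z : ℝ => z) (ENNReal.ofReal q) ν := by
  rw [← integrable_norm_rpow_iff (f := fun z : ℝ => z) measurable_id.aestronglyMeasurable
    (by simpa using hq) ENNReal.ofReal_ne_top, ENNReal.toReal_ofReal hq.le]
  simpa using hmom

variable [IsProbabilityMeasure ν]

lemma integrable_id_of_integrable_rpow {q : ℝ} (hq : 1 ≤ q)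
    (hmom : Integrable (fun z : ℝ => |z| ^ q) ν) : Integrable (fun z : ℝ => z) ν :=
  (memLp_id_of_integrable_rpow (by linarith) hmom).integrable (by simpa using hq)

lemma integrable_abs_add_rpow {q : ℝ} (hq : 0 < q)
    (hmom : Integrable (fun z : ℝ => |z| ^ q) ν) {κ : ℝ} (hκ : 0 ≤ κ) :
    Integrable (fun z : ℝ => (|z| + κ) ^ q) ν := by
  have h := (memLp_id_of_integrable_rpow hq hmom).norm.add
    (memLp_const (μ := ν) (p := ENNReal.ofReal q) κ)
  have h2 := (integrable_norm_rpow_iff h.1 (by simpa using hq) ENNReal.ofReal_ne_top).2 h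
  rw [ENNReal.toReal_ofReal hq.le] at h2
  refine h2.congr (Eventually.of_forall fun z => ?_)
  have : 0 ≤ |z| + κ := by positivity
  simp [abs_of_nonneg this]

/-- The mean overshoot below `-r` decays polynomially in `r`. -/
lemma integral_overshoot_le {δ : ℝ} (hδ : 0 < δ)
    (hmom : Integrable (fun z : ℝ => |z| ^ (2 + δ)) ν) {κ r : ℝ} (hκ : 0 < κ) (hr : 0 ≤ r) :
    ∫ z, max (-r - z) 0 ∂ν ≤ (∫ z, (|z| + κ) ^ (2 + δ) ∂ν) * (r + κ) ^ (-(1 + δ)) := by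
  have hi := integrable_abs_add_rpow (by linarith) hmom hκ.le
  rw [← integral_mul_const]
  refine integral_mono_of_nonneg (Eventually.of_forall fun z => le_max_right _ _)
    (hi.mul_const _) (Eventually.of_forall fun z => ?_)
  have h0 : 0 < |z| + κ := by positivity
  have h1 : 0 < r + κ := by positivity
  refine max_le ?_ (by positivity)
  rcases le_or_gt (-r) z with hz | hz
  · exact le_trans (by linarith) (by positivity : (0 : ℝ) ≤ (|z| + κ) ^ (2 + δ) * _)
  · have h2 : r + κ ≤ |z| + κ := by
      have := neg_le_abs z
      linarith
    calc -r - z ≤ |z| + κ := by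
          have := neg_le_abs z
          linarith
      _ = (|z| + κ) ^ (2 + δ) * (|z| + κ) ^ (-(1 + δ)) := by
          rw [← Real.rpow_add h0]
          norm_num
      _ ≤ _ := by
          refine mul_le_mul_of_nonneg_left ?_ (by positivity)
          exact Real.rpow_le_rpow_of_nonpos h1 h2 (by linarith)

/-- The positive half-line is the union of the half-lines above 1/(n+1), so one of these carries
mass. The resulting excess is the gain that compensates the drift of |y|. -/
lemma exists_pos_integral_excess (hint : Integrable (fun z : ℝ => z) ν)
    (hpos : 0 < ν (Set.Ioi 0)) : ∃ κ : ℝ, 0 < κ ∧ 0 < ∫ z, max (z - κ) 0 ∂ν := by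
  by_contra! hcon
  have hnull : ∀ n : ℕ, ν (Set.Ioi (1 / ((n : ℝ) + 1))) = 0 := by
    intro n
    have hκ : 0 < 1 / ((n : ℝ) + 1) := by positivity
    have h1 := hcon _ hκ
    have h2 : 0 ≤ ∫ z, max (z - 1 / ((n : ℝ) + 1)) 0 ∂ν :=
      integral_nonneg fun z => le_max_right _ _
    have hi : Integrable (fun z : ℝ => max (z - 1 / ((n : ℝ) + 1)) 0) ν :=
      (hint.sub (integrable_const _)).pos_part
    have h3 := (integral_eq_zero_iff_of_nonneg (fun z => le_max_right _ _) hi).1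
      (le_antisymm h1 h2)
    refine measure_mono_null (fun z hz => ?_) (ae_iff.1 h3)
    simp only [Set.mem_Ioi] at hz
    simp only [Set.mem_ofPred_eq, Pi.zero_apply]
    rw [max_eq_left (by linarith)]
    linarith
  have : Set.Ioi (0 : ℝ) ⊆ ⋃ n : ℕ, Set.Ioi (1 / ((n : ℝ) + 1)) := fun z hz => by
    obtain ⟨n, hn⟩ := exists_nat_one_div_lt (Set.mem_Ioi.1 hz)
    exact Set.mem_iUnion.2 ⟨n, hn⟩
  exact hpos.ne' (measure_mono_null this (measure_iUnion_null hnull))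

/-- A mixture of truncated identities, concave above `-L` and constant below. -/
noncomputable def concaveMixture (c s : ℕ → ℝ) (L y : ℝ) : ℝ :=
  ∑' j, c j * min (max y (-L)) (s j)

/-! ### Mixtures of truncated identities -/

section Mixture

variable {c s : ℕ → ℝ} {L : ℝ}

lemma abs_trunc_le {L y t : ℝ} (hL : 0 ≤ L) (ht : 0 < t) : |min (max y (-L)) t| ≤ |y| + L := by
  rw [abs_le]
  have h1 := abs_nonneg y
  have h2 := neg_abs_le y
  have h3 := le_abs_self y
  constructor
  · exact le_min (le_trans (by linarith) (le_max_right _ _)) (by linarith)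
  · exact (min_le_left _ _).trans (max_le (by linarith) (by linarith))

lemma summable_mixture (hc : ∀ j, 0 ≤ c j) (hsum : Summable c) (hs : ∀ j, 0 < s j) (hL : 0 ≤ L)
    (y : ℝ) : Summable fun j => c j * min (max y (-L)) (s j) := by
  refine Summable.of_norm_bounded (hsum.mul_right (|y| + L)) fun j => ?_
  rw [norm_mul, Real.norm_of_nonneg (hc j), Real.norm_eq_abs]
  exact mul_le_mul_of_nonneg_left (abs_trunc_le hL (hs j)) (hc j)

lemma measurable_concaveMixture (hc : ∀ j, 0 ≤ c j) (hsum : Summable c) (hs : ∀ j, 0 < s j)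
    (hL : 0 ≤ L) : Measurable (concaveMixture c s L) := by
  refine Monotone.measurable fun y z hyz => ?_
  exact (summable_mixture hc hsum hs hL y).tsum_le_tsum
    (fun j => mul_le_mul_of_nonneg_left (min_le_min_right _ (max_le_max_right _ hyz)) (hc j))
    (summable_mixture hc hsum hs hL z)

lemma concaveMixture_le (hc : ∀ j, 0 ≤ c j) (hsum : Summable c) (hs : ∀ j, 0 < s j)
    (hL : 0 ≤ L) (y : ℝ) : concaveMixture c s L y ≤ (∑' j, c j) * |y| := by
  rw [← tsum_mul_right]
  refine (summable_mixture hc hsum hs hL y).tsum_le_tsum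
    (fun j => mul_le_mul_of_nonneg_left ?_ (hc j)) (hsum.mul_right _)
  refine (min_le_left _ _).trans (max_le (le_abs_self y) ?_)
  have := abs_nonneg y
  linarith

lemma le_concaveMixture (hc : ∀ j, 0 ≤ c j) (hsum : Summable c) (hs : ∀ j, 0 < s j)
    (hL : 0 ≤ L) (y : ℝ) : (∑' j, c j) * (-L) ≤ concaveMixture c s L y := by
  rw [← tsum_mul_right]
  refine (hsum.mul_right _).tsum_le_tsum
    (fun j => mul_le_mul_of_nonneg_left ?_ (hc j)) (summable_mixture hc hsum hs hL y)
  exact le_min (le_max_right _ _) (by linarith [hs j])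

lemma integrable_trunc (hint : Integrable (fun z : ℝ => z) ν) (hL : 0 ≤ L) (y : ℝ) {t : ℝ}
    (ht : 0 < t) : Integrable (fun z => min (max (y + z) (-L)) t) ν := by
  refine Integrable.mono' (((integrable_const y).add hint).abs.add (integrable_const L))
    (by fun_prop) (Eventually.of_forall fun z => ?_)
  exact abs_trunc_le hL ht

lemma trunc_le {L u t : ℝ} (hL : 0 ≤ L) (ht : 0 < t) :
    min (max u (-L)) t ≤ min u t + max (-L - u) 0 := by
  rcases le_total u (-L) with h | h
  · rw [max_eq_right h, min_eq_left (by linarith), min_eq_left (by linarith),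
      max_eq_left (by linarith)]
    linarith
  · rw [max_eq_left h]
    linarith [le_max_right (-L - u) 0]

/-- Jensen for the concave function min(·, t); the floor at -L destroys concavity only at the price
of the mean overshoot below -L. -/
lemma integral_trunc_le (hint : Integrable (fun z : ℝ => z) ν) (hmean : ∫ z, z ∂ν = 0)
    (hL : 0 ≤ L) {y t : ℝ} (hy : 0 < y) (ht : 0 < t) :
    ∫ z, min (max (y + z) (-L)) t ∂ν ≤
      min (max y (-L)) t + ∫ z, max (-(y + L) - z) 0 ∂ν := by
  have hyz : Integrable (fun z => y + z) ν := (integrable_const y).add hint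
  have h1 : Integrable (fun z => min (y + z) t) ν := hyz.inf (integrable_const t)
  have h2 : Integrable (fun z => max (-(y + L) - z) 0) ν :=
    ((integrable_const _).sub hint).pos_part
  have h3 : ∫ z, min (y + z) t ∂ν ≤ min y t := by
    refine le_min ?_ ?_
    · calc _ ≤ ∫ z, (y + z) ∂ν := integral_mono h1 hyz fun z => min_le_left _ _
        _ = y := by rw [integral_add (integrable_const y) hint, hmean]; simp
    · calc _ ≤ ∫ _, t ∂ν := integral_mono h1 (integrable_const t) fun z => min_le_right _ _
        _ = t := by simp
  rw [max_eq_left (by linarith : -L ≤ y)]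
  calc _ ≤ ∫ z, (min (y + z) t + max (-(y + L) - z) 0) ∂ν := by
        refine integral_mono (integrable_trunc hint hL y ht) (h1.add h2) fun z => ?_
        have := trunc_le (u := y + z) hL ht
        rwa [show -L - (y + z) = -(y + L) - z by ring] at this
    _ ≤ _ := by
        rw [integral_add h1 h2]
        linarith

/-- When the kink t lies between y and y + κ, a jump z > κ certainly crosses it, and truncation
loses at least z - κ. This makes Jensen's inequality strict by a fixed amount. -/
lemma integral_trunc_le_sub (hint : Integrable (fun z : ℝ => z) ν) (hmean : ∫ z, z ∂ν = 0)
    (hL : 0 ≤ L) {y t κ : ℝ} (hy : 0 < y) (hyt : y ≤ t) (hty : t ≤ y + κ) :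
    ∫ z, min (max (y + z) (-L)) t ∂ν ≤
      min (max y (-L)) t + ∫ z, max (-(y + L) - z) 0 ∂ν - ∫ z, max (z - κ) 0 ∂ν := by
  have hyz : Integrable (fun z => y + z) ν := (integrable_const y).add hint
  have h2 : Integrable (fun z => max (-(y + L) - z) 0) ν :=
    ((integrable_const _).sub hint).pos_part
  have h4 : Integrable (fun z => max (z - κ) 0) ν := (hint.sub (integrable_const _)).pos_part
  rw [max_eq_left (by linarith : -L ≤ y), min_eq_left hyt]
  have ht : 0 < t := by linarith
  calc _ ≤ ∫ z, (y + z + max (-(y + L) - z) 0 - max (z - κ) 0) ∂ν := by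
        refine integral_mono (integrable_trunc hint hL y ht) ((hyz.add h2).sub h4) fun z => ?_
        have := trunc_le (u := y + z) hL ht
        rw [show -L - (y + z) = -(y + L) - z by ring] at this
        refine this.trans ?_
        have h5 : min (y + z) t ≤ y + z - max (z - κ) 0 := by
          rcases le_total z κ with h | h
          · rw [max_eq_right (by linarith)]
            linarith [min_le_left (y + z) t]
          · rw [max_eq_left (by linarith)]
            linarith [min_le_right (y + z) t]
        linarith
    _ = _ := by
        have h3 : Integrable (fun z => y + z + max (-(y + L) - z) 0) ν := hyz.add h2
        rw [integral_sub h3 h4, integral_add hyz h2,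
          integral_add (integrable_const y) hint, hmean]
        simp

/-- Every term pays the floor error, but the term whose kink is close to y also yields the strict
gain; integration and summation are exchanged. -/
lemma integral_concaveMixture_le (hc : ∀ j, 0 ≤ c j) (hsum : Summable c) (hs : ∀ j, 0 < s j)
    (hL : 0 ≤ L) (hint : Integrable (fun z : ℝ => z) ν) (hmean : ∫ z, z ∂ν = 0) {y κ : ℝ}
    (hy : 0 < y) {i : ℕ} (hyi : y ≤ s i) (hiy : s i ≤ y + κ) :
    ∫ z, concaveMixture c s L (y + z) ∂ν ≤ concaveMixture c s L y +
      (∑' j, c j) * ∫ z, max (-(y + L) - z) 0 ∂ν - c i * ∫ z, max (z - κ) 0 ∂ν := by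
  set η := ∫ z, max (-(y + L) - z) 0 ∂ν
  set e := ∫ z, max (z - κ) 0 ∂ν
  have hI : ∀ j, Integrable (fun z => c j * min (max (y + z) (-L)) (s j)) ν := fun j =>
    (integrable_trunc hint hL y (hs j)).const_mul _
  have habs : Integrable (fun z => |y + z| + L) ν :=
    ((integrable_const y).add hint).abs.add (integrable_const L)
  have hS : Summable fun j => ∫ z, ‖c j * min (max (y + z) (-L)) (s j)‖ ∂ν := by
    refine Summable.of_nonneg_of_le (fun j => integral_nonneg fun z => norm_nonneg _)
      (fun j => ?_) (hsum.mul_right (∫ z, (|y + z| + L) ∂ν))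
    rw [← integral_const_mul]
    refine integral_mono (hI j).norm (habs.const_mul _) fun z => ?_
    simp only [norm_mul, Real.norm_of_nonneg (hc j)]
    exact mul_le_mul_of_nonneg_left (abs_trunc_le hL (hs j)) (hc j)
  have hsumr : HasSum (fun j => c j * min (max y (-L)) (s j) + c j * η - if j = i then c i * e else 0)
      (concaveMixture c s L y + (∑' j, c j) * η - c i * e) :=
    ((summable_mixture hc hsum hs hL y).hasSum.add (hsum.hasSum.mul_right η)).sub
      (hasSum_ite_eq i (c i * e))
  unfold concaveMixture at *
  rw [← integral_tsum_of_summable_integral_norm hI hS]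
  refine hasSum_le (fun j => ?_)
    (hasSum_integral_of_summable_integral_norm hI hS).summable.hasSum hsumr
  rw [integral_const_mul]
  split_ifs with hj
  · subst hj
    have := mul_le_mul_of_nonneg_left
      (integral_trunc_le_sub (ν := ν) hint hmean hL hy hyi hiy) (hc j)
    linarith
  · have := mul_le_mul_of_nonneg_left
      (integral_trunc_le (ν := ν) hint hmean hL hy (hs j)) (hc j)
    linarith

end Mixture

/-- A centred non-degenerate law with a moment of order `2 + δ` admits a function of linear growth,
larger than `|y|`, which is superharmonic on the positive half-line. -/
theorem exists_superharmonic {δ : ℝ} (hδ : 0 < δ)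
    (hmom : Integrable (fun z : ℝ => |z| ^ (2 + δ)) ν) (hmean : ∫ z, z ∂ν = 0)
    (hpos : 0 < ν (Set.Ioi 0)) :
    ∃ (V : ℝ → ℝ) (C : ℝ), 0 ≤ C ∧ Measurable V ∧ (∀ y, |y| ≤ V y) ∧
      (∀ y, V y ≤ C * (1 + |y|)) ∧ ∀ y, 0 < y → ∫ z, V (y + z) ∂ν ≤ V y := by
  have hint := integrable_id_of_integrable_rpow (by linarith) hmom
  obtain ⟨κ, hκ, he⟩ := exists_pos_integral_excess hint hpos
  set e := ∫ z, max (z - κ) 0 ∂ν with he_def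
  set p := δ / 2 with hp
  have hp0 : 0 < p := by positivity
  -- With p = δ/2 the weights are summable and yet decay more slowly than the overshoot, which is of
  -- order y^{-(1+δ)}.
  set c : ℕ → ℝ := fun j => ((j : ℝ) + 1) ^ (-(1 + p)) with hc_def
  set s : ℕ → ℝ := fun j => ((j : ℝ) + 1) * κ with hs_def
  have hc : ∀ j, 0 ≤ c j := fun j => by positivity
  have hs : ∀ j, 0 < s j := fun j => by positivity
  have hsum : Summable c := by
    have := (summable_nat_add_iff 1).2
      (Real.summable_nat_rpow.2 (by linarith : -(1 + p) < -1))
    simpa [c] using this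
  set C₀ := ∑' j, c j with hC₀
  have hC₀n : 0 ≤ C₀ := tsum_nonneg hc
  set M₁ := (∫ z, (|z| + κ) ^ (2 + δ) ∂ν) * κ ^ (-(1 + δ)) with hM₁
  have hM₁n : 0 ≤ M₁ := mul_nonneg (integral_nonneg fun z => by positivity) (by positivity)
  -- The floor -L is put so low that its error uses at most half of the gain.
  obtain ⟨l, hl1, hl⟩ : ∃ l : ℝ, 1 ≤ l ∧ C₀ * M₁ * l ^ (-p) ≤ e / 2 := by
    have h := (tendsto_rpow_neg_atTop hp0).const_mul (C₀ * M₁)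
    rw [mul_zero] at h
    have h2 := (h.eventually (gt_mem_nhds (half_pos he))).and (eventually_ge_atTop 1)
    obtain ⟨l, h3, h4⟩ := h2.exists
    exact ⟨l, h4, h3.le⟩
  set L := κ * l with hL_def
  have hL : 0 ≤ L := by positivity
  -- Chosen so that K times the remaining half gain e/2 equals 2M₁, the constant in the bound for
  -- the drift of |y|.
  set K := 4 * M₁ / e with hK
  have hKn : 0 ≤ K := by positivity
  have hover : ∀ w, 1 ≤ w → ∫ z, max (-(κ * w - κ) - z) 0 ∂ν ≤ M₁ * w ^ (-(1 + δ)) := by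
    intro w hw
    refine (integral_overshoot_le hδ hmom hκ (by nlinarith)).trans (le_of_eq ?_)
    rw [sub_add_cancel, Real.mul_rpow hκ.le (by linarith)]
    ring
  have hφm := measurable_concaveMixture hc hsum hs hL
  have hφle := concaveMixture_le hc hsum hs hL
  have hleφ := le_concaveMixture hc hsum hs hL
  set φ := concaveMixture c s L
  refine ⟨fun y => |y| + K * (φ y + C₀ * L), 1 + K * C₀ + K * (C₀ * L), by positivity,
    by fun_prop, fun y => ?_, fun y => ?_, fun y hy => ?_⟩
  · have := mul_nonneg hKn (by linarith [hleφ y] : 0 ≤ φ y + C₀ * L)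
    linarith
  · have h1 := mul_le_mul_of_nonneg_left (hφle y) hKn
    have h2 : 0 ≤ K * C₀ := by positivity
    have h3 : 0 ≤ K * (C₀ * L) * |y| := by positivity
    nlinarith [abs_nonneg y]
  · have hyz : Integrable (fun z => y + z) ν := (integrable_const y).add hint
    have hφi : Integrable (fun z => φ (y + z)) ν := by
      refine Integrable.mono' ((hyz.abs.const_mul C₀).add (integrable_const (C₀ * L)))
        (hφm.comp (measurable_const_add y)).aestronglyMeasurable
        (Eventually.of_forall fun z => ?_)
      simp only [Pi.add_apply]
      rw [Real.norm_eq_abs, abs_le]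
      have h1 := hφle (y + z)
      have h2 := hleφ (y + z)
      have h3 : 0 ≤ C₀ * |y + z| := by positivity
      have h4 : 0 ≤ C₀ * L := by positivity
      constructor <;> linarith
    have habs : ∫ z, |y + z| ∂ν = y + 2 * ∫ z, max (-y - z) 0 ∂ν := by
      have h2 : Integrable (fun z => max (-y - z) 0) ν :=
        ((integrable_const _).sub hint).pos_part
      have h3 : ∀ z, |y + z| = (y + z) + 2 * max (-y - z) 0 := by
        intro z
        rcases le_total 0 (y + z) with h | h
        · rw [abs_of_nonneg h, max_eq_right (by linarith)]; ring
        · rw [abs_of_nonpos h, max_eq_left (by linarith)]; ring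
      simp only [h3]
      rw [integral_add hyz (h2.const_mul 2), integral_add (integrable_const y) hint, hmean,
        integral_const_mul]
      simp
    have hsplit : ∫ z, (|y + z| + K * (φ (y + z) + C₀ * L)) ∂ν =
        ∫ z, |y + z| ∂ν + K * (∫ z, φ (y + z) ∂ν + C₀ * L) := by
      have h2 : Integrable (fun z => φ (y + z) + C₀ * L) ν := hφi.add (integrable_const _)
      rw [integral_add hyz.abs (h2.const_mul K), integral_const_mul,
        integral_add hφi (integrable_const _)]
      simp
    set w := y / κ + 1 with hw
    have hyκ : 0 < y / κ := by positivity
    have hw1 : 1 ≤ w := by linarith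
    have hκw : κ * w - κ = y := by rw [hw]; field_simp; ring
    have hκwl : κ * (w + l) - κ = y + L := by rw [mul_add]; linarith
    -- The index of the kink just above y, at distance at most κ.
    set i := ⌊y / κ⌋₊ with hi
    have hi1 : y ≤ s i := by
      have := (Nat.lt_floor_add_one (y / κ)).le
      rw [div_le_iff₀ hκ] at this
      exact this
    have hi2 : (i : ℝ) + 1 ≤ w := by
      have := Nat.floor_le hyκ.le
      linarith
    have hi3 : s i ≤ y + κ := by
      have := mul_le_mul_of_nonneg_right hi2 hκ.le
      rw [← hκw]
      linarith
    have hmix := integral_concaveMixture_le (ν := ν) hc hsum hs hL hint hmean hy hi1 hi3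
    have hg1 := hover w hw1
    have hg2 := hover (w + l) (by linarith)
    rw [hκw] at hg1
    rw [hκwl] at hg2
    set u := w ^ (-(1 + p)) with hu
    have hu0 : 0 < u := by positivity
    have hcu : u ≤ c i :=
      Real.rpow_le_rpow_of_nonpos (by positivity) hi2 (by linarith)
    have hg1' : w ^ (-(1 + δ)) ≤ u :=
      Real.rpow_le_rpow_of_exponent_le hw1 (by linarith)
    -- Since 1 + δ = (1 + p) + p, one part of the exponent matches the weight near y and the other
    -- yields smallness in l.
    have hg2' : (w + l) ^ (-(1 + δ)) ≤ u * l ^ (-p) := by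
      rw [show -(1 + δ) = -(1 + p) + -p by rw [hp]; ring, Real.rpow_add (by linarith)]
      refine mul_le_mul (Real.rpow_le_rpow_of_nonpos (by linarith) (by linarith) (by linarith))
        (Real.rpow_le_rpow_of_nonpos (by linarith) (by linarith) (by linarith))
        (by positivity) hu0.le
    change ∫ z, (|y + z| + K * (φ (y + z) + C₀ * L)) ∂ν ≤ |y| + K * (φ y + C₀ * L)
    rw [hsplit, habs, abs_of_pos hy]
    have k1 : ∫ z, max (-y - z) 0 ∂ν ≤ M₁ * u :=
      hg1.trans (mul_le_mul_of_nonneg_left hg1' hM₁n)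
    have k2 : C₀ * ∫ z, max (-(y + L) - z) 0 ∂ν ≤ e / 2 * u := by
      calc _ ≤ C₀ * (M₁ * (u * l ^ (-p))) :=
            mul_le_mul_of_nonneg_left (hg2.trans (mul_le_mul_of_nonneg_left hg2' hM₁n)) hC₀n
        _ = C₀ * M₁ * l ^ (-p) * u := by ring
        _ ≤ _ := mul_le_mul_of_nonneg_right hl hu0.le
    have k3 : u * e ≤ c i * e := mul_le_mul_of_nonneg_right hcu he.le
    have k4 : ∫ z, φ (y + z) ∂ν ≤ φ y - e / 2 * u := by
      have : ∫ z, φ (y + z) ∂ν ≤ φ y + C₀ * ∫ z, max (-(y + L) - z) 0 ∂ν - c i * e := hmix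
      linarith
    have k5 := mul_le_mul_of_nonneg_left k4 hKn
    have k6 : K * (e / 2 * u) = 2 * (M₁ * u) := by rw [hK]; field_simp; ring
    nlinarith

end Lyapunov

/-! ### Lower deviations of a walk with positive drift -/

section LowerDeviation

lemma exp_le_one_add_add_sq_mul {v B : ℝ} (hB : 0 ≤ B) (hv : v ≤ B) :
    Real.exp v ≤ 1 + v + v ^ 2 * Real.exp B := by
  have hB1 : 1 ≤ Real.exp B := Real.one_le_exp hB
  have hsq : v ^ 2 ≤ v ^ 2 * Real.exp B := le_mul_of_one_le_right (sq_nonneg v) hB1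
  rcases lt_or_ge v (-1) with h | h
  · have : Real.exp v ≤ 1 := Real.exp_le_one_iff.2 (by linarith)
    nlinarith
  rcases le_or_gt v 1 with h' | h'
  · have := (abs_le.1 (Real.abs_exp_sub_one_sub_id_le (abs_le.2 ⟨h, h'⟩))).2
    linarith
  · have h1 : Real.exp v ≤ Real.exp B := Real.exp_le_exp.2 hv
    have h2 : 1 ≤ v ^ 2 := by nlinarith
    nlinarith [Real.exp_pos B]

variable {Ω : Type*} [MeasurableSpace Ω] {P : Measure Ω} [IsProbabilityMeasure P]

/-- A bound for the moment generating function of a variable truncated from below. -/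
lemma mgf_truncated_le {Y : Ω → ℝ} (hY : Measurable Y) (hi : Integrable Y P)
    (hi2 : Integrable (fun ω => Y ω ^ 2) P) {b l : ℝ} (hb : 0 ≤ b) (hl : 0 ≤ l) :
    Integrable (fun ω => Real.exp (-l * max (Y ω) (-b))) P ∧
    mgf (fun ω => max (Y ω) (-b)) P (-l) ≤
      Real.exp (-(l * ∫ ω, Y ω ∂P) + l ^ 2 * (∫ ω, Y ω ^ 2 ∂P) * Real.exp (l * b)) := by
  have hv : ∀ ω, -l * max (Y ω) (-b) ≤ l * b := fun ω => by
    have := mul_le_mul_of_nonneg_left (le_max_right (Y ω) (-b)) hl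
    linarith
  have hexp : Integrable (fun ω => Real.exp (-l * max (Y ω) (-b))) P := by
    refine Integrable.of_bound (by fun_prop) (Real.exp (l * b)) (Eventually.of_forall fun ω => ?_)
    rw [Real.norm_of_nonneg (Real.exp_pos _).le]
    exact Real.exp_le_exp.2 (hv ω)
  refine ⟨hexp, ?_⟩
  have hbound : ∀ ω, Real.exp (-l * max (Y ω) (-b)) ≤
      1 - l * Y ω + l ^ 2 * Y ω ^ 2 * Real.exp (l * b) := by
    intro ω
    refine (exp_le_one_add_add_sq_mul (mul_nonneg hl hb) (hv ω)).trans ?_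
    have h1 : l * Y ω ≤ l * max (Y ω) (-b) := mul_le_mul_of_nonneg_left (le_max_left _ _) hl
    have h2 : (max (Y ω) (-b)) ^ 2 ≤ Y ω ^ 2 := by
      rcases le_total (-b) (Y ω) with h | h
      · rw [max_eq_left h]
      · rw [max_eq_right h]
        nlinarith
    have h3 : (-l * max (Y ω) (-b)) ^ 2 * Real.exp (l * b) ≤
        l ^ 2 * Y ω ^ 2 * Real.exp (l * b) := by
      rw [mul_pow, neg_sq]
      gcongr
    linarith
  have hI : Integrable (fun ω => 1 - l * Y ω + l ^ 2 * Y ω ^ 2 * Real.exp (l * b)) P :=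
    ((integrable_const 1).sub (hi.const_mul l)).add ((hi2.const_mul _).mul_const _)
  calc mgf (fun ω => max (Y ω) (-b)) P (-l)
      ≤ ∫ ω, (1 - l * Y ω + l ^ 2 * Y ω ^ 2 * Real.exp (l * b)) ∂P :=
        integral_mono hexp hI hbound
    _ = (-(l * ∫ ω, Y ω ∂P) + l ^ 2 * (∫ ω, Y ω ^ 2 ∂P) * Real.exp (l * b)) + 1 := by
        have h1 : Integrable (fun ω => 1 - l * Y ω) P := (integrable_const 1).sub (hi.const_mul l)
        rw [integral_add h1 ((hi2.const_mul _).mul_const _), integral_sub (integrable_const 1) (hi.const_mul l),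
          integral_const_mul, integral_mul_const, integral_const_mul]
        simp
        ring
    _ ≤ _ := Real.add_one_le_exp _

/-- A walk with positive drift whose increments have a negative part with finite moment of order
`3 + δ` is non-positive at time `m` with probability of order `m ^ (-(2 + δ))`. -/
theorem exists_measure_sum_nonpos_le {Y : ℕ → Ω → ℝ} (hY : ∀ n, Measurable (Y n))
    (hindep : iIndepFun Y P) (hident : ∀ n, IdentDistrib (Y n) (Y 0) P P)
    (hi2 : Integrable (fun ω => Y 0 ω ^ 2) P) (hi : Integrable (Y 0) P)
    (hmean : 0 < ∫ ω, Y 0 ω ∂P) {δ : ℝ} (hδ : 0 < δ)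
    (hneg : Integrable (fun ω => (max (-Y 0 ω) 0) ^ (3 + δ)) P) :
    ∃ K : ℝ, ∀ m : ℕ, 1 ≤ m →
      P.real {ω | ∑ k ∈ Finset.range m, Y k ω ≤ 0} ≤ K * (m : ℝ) ^ (-(2 + δ)) := by
  set μ := ∫ ω, Y 0 ω ∂P with hμ
  set σ := ∫ ω, Y 0 ω ^ 2 ∂P with hσ
  have hσ0 : 0 ≤ σ := integral_nonneg fun ω => sq_nonneg _
  set N := ∫ ω, (max (-Y 0 ω) 0) ^ (3 + δ) ∂P with hN
  have hN0 : 0 ≤ N := integral_nonneg fun ω => by positivity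
  -- With truncation level b = am and exponent l = κ log m / m, the drift term is mlμ = (3 + δ) log
  -- m and exp(lb) is only √m. The quadratic term κ²σ log²m / √m is then bounded, since log m ≤
  -- 4m^{1/4}.
  set κ := (3 + δ) / μ with hκ
  have hκ0 : 0 < κ := by positivity
  set a := 1 / (2 * κ) with ha
  have ha0 : 0 < a := by positivity
  refine ⟨N * a ^ (-(3 + δ)) + Real.exp (κ ^ 2 * σ * 16), fun m hm => ?_⟩
  have hm1 : (1 : ℝ) ≤ m := by exact_mod_cast hm
  have hm0 : (0 : ℝ) < m := by linarith
  set b := a * m with hb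
  have hb0 : 0 < b := by positivity
  have hlog : 0 ≤ Real.log m := Real.log_nonneg hm1
  set l := κ * Real.log m / m with hl
  have hl0 : 0 ≤ l := by positivity
  have hjump : ∀ k, P.real {ω | Y k ω < -b} ≤ N * b ^ (-(3 + δ)) := by
    intro k
    have h1 : P.real {ω | Y k ω < -b} = P.real {ω | Y 0 ω < -b} := by
      rw [measureReal_def, measureReal_def]
      congr 1
      exact (hident k).measure_mem_eq (measurableSet_Iio (a := -b))
    rw [h1]
    have h2 := mul_meas_ge_le_integral_of_nonneg
      (Eventually.of_forall fun ω => (by positivity : (0 : ℝ) ≤ (max (-Y 0 ω) 0) ^ (3 + δ)))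
      hneg (b ^ (3 + δ))
    have h3 : P.real {ω | Y 0 ω < -b} ≤ P.real {ω | b ^ (3 + δ) ≤ (max (-Y 0 ω) 0) ^ (3 + δ)} := by
      refine measureReal_mono fun ω hω => ?_
      simp only [Set.mem_ofPred_eq] at hω ⊢
      refine Real.rpow_le_rpow hb0.le (le_trans ?_ (le_max_left _ _)) (by linarith)
      linarith
    rw [Real.rpow_neg hb0.le, ← div_eq_mul_inv, le_div_iff₀ (by positivity), mul_comm]
    exact (mul_le_mul_of_nonneg_left h3 (by positivity)).trans h2
  set Y' : ℕ → Ω → ℝ := fun k ω => max (Y k ω) (-b) with hY'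
  have hY'm : ∀ k, Measurable (Y' k) := fun k => (hY k).max measurable_const
  have hY'ind : iIndepFun Y' P :=
    hindep.comp (fun _ y => max y (-b)) fun _ => measurable_id.max measurable_const
  have hmgf : ∀ k, mgf (Y' k) P (-l) ≤ Real.exp (-(l * μ) + l ^ 2 * σ * Real.exp (l * b)) := by
    intro k
    have : IdentDistrib (Y' k) (Y' 0) P P :=
      (hident k).comp (u := fun y => max y (-b)) (measurable_id.max measurable_const)
    rw [mgf_congr_identDistrib this]
    exact (mgf_truncated_le (hY 0) hi hi2 hb0.le hl0).2
  have hchern : P.real {ω | ∑ k ∈ Finset.range m, Y' k ω ≤ 0} ≤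
      Real.exp (κ ^ 2 * σ * 16) * (m : ℝ) ^ (-(2 + δ)) := by
    have hint : Integrable (fun ω => Real.exp (-l * (∑ k ∈ Finset.range m, Y' k) ω)) P := by
      refine hY'ind.integrable_exp_mul_sum hY'm (s := Finset.range m) fun k _ => ?_
      exact (mgf_truncated_le (hY k) ((hident k).integrable_iff.2 hi)
        (((hident k).comp (u := fun y => y ^ 2) (by fun_prop)).integrable_iff.2 hi2)
        hb0.le hl0).1
    have h1 := measure_le_le_exp_mul_mgf 0 (by linarith : -l ≤ 0) hint
    simp only [Finset.sum_apply] at h1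
    refine h1.trans ?_
    rw [mul_zero, Real.exp_zero, one_mul, hY'ind.mgf_sum hY'm]
    calc ∏ k ∈ Finset.range m, mgf (Y' k) P (-l)
        ≤ ∏ k ∈ Finset.range m, Real.exp (-(l * μ) + l ^ 2 * σ * Real.exp (l * b)) :=
          Finset.prod_le_prod (fun k _ => mgf_nonneg) fun k _ => hmgf k
      _ = Real.exp (m * (-(l * μ) + l ^ 2 * σ * Real.exp (l * b))) := by
          rw [Finset.prod_const, Finset.card_range, Real.exp_nat_mul]
      _ ≤ Real.exp (κ ^ 2 * σ * 16 + Real.log m * (-(3 + δ))) := by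
          refine Real.exp_le_exp.2 ?_
          have e1 : Real.exp (l * b) = (m : ℝ) ^ (1 / 2 : ℝ) := by
            rw [Real.rpow_def_of_pos hm0]
            congr 1
            rw [hl, hb, ha]
            field_simp
          have e2 : (m : ℝ) * (l * μ) = Real.log m * (3 + δ) := by
            rw [hl, hκ]
            field_simp
          have e3 : (Real.log m) ^ 2 ≤ 16 * (m : ℝ) ^ (1 / 2 : ℝ) := by
            have h4 := Real.log_le_rpow_div hm0.le (by norm_num : (0 : ℝ) < 1 / 4)
            have h5 : ((m : ℝ) ^ (1 / 4 : ℝ)) ^ 2 = (m : ℝ) ^ (1 / 2 : ℝ) := by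
              rw [← Real.rpow_natCast, ← Real.rpow_mul hm0.le]
              norm_num
            have h6 := pow_le_pow_left₀ hlog h4 2
            rw [div_pow, h5] at h6
            refine h6.trans (le_of_eq ?_)
            ring
          have e4 : ((m : ℝ) ^ (1 / 2 : ℝ)) * (m : ℝ) ^ (1 / 2 : ℝ) = m := by
            rw [← Real.rpow_add hm0]
            norm_num
          have e5 : (m : ℝ) * (l ^ 2 * σ * Real.exp (l * b)) ≤ κ ^ 2 * σ * 16 := by
            rw [e1]
            set r := (m : ℝ) ^ (1 / 2 : ℝ)
            have hr : 0 < r := by positivity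
            calc (m : ℝ) * (l ^ 2 * σ * r) = κ ^ 2 * σ * ((Real.log m) ^ 2 * r / m) := by
                  rw [hl]
                  field_simp
              _ ≤ κ ^ 2 * σ * 16 := by
                  refine mul_le_mul_of_nonneg_left ?_ (by positivity)
                  rw [div_le_iff₀ hm0]
                  nlinarith
          linarith
      _ = Real.exp (κ ^ 2 * σ * 16) * (m : ℝ) ^ (-(3 + δ)) := by
          rw [Real.exp_add, Real.rpow_def_of_pos hm0]
      _ ≤ _ := by
          refine mul_le_mul_of_nonneg_left ?_ (Real.exp_pos _).le
          exact Real.rpow_le_rpow_of_exponent_le hm1 (by linarith)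
  -- Either some jump is below -b, which Markov's inequality and a union bound make O(m ·
  -- m^{-(3+δ)}), or truncation changes nothing and the Chernoff bound applies.
  have hsub : {ω | ∑ k ∈ Finset.range m, Y k ω ≤ 0} ⊆
      (⋃ k ∈ Finset.range m, {ω | Y k ω < -b}) ∪ {ω | ∑ k ∈ Finset.range m, Y' k ω ≤ 0} := by
    intro ω hω
    by_cases h : ∃ k ∈ Finset.range m, Y k ω < -b
    · left
      simpa using h
    · right
      push Not at h
      simp only [Set.mem_ofPred_eq] at hω ⊢
      refine le_trans (le_of_eq (Finset.sum_congr rfl fun k hk => ?_)) hω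
      exact max_eq_left (h k hk)
  calc _ ≤ P.real ((⋃ k ∈ Finset.range m, {ω | Y k ω < -b}) ∪
        {ω | ∑ k ∈ Finset.range m, Y' k ω ≤ 0}) := measureReal_mono hsub
    _ ≤ P.real (⋃ k ∈ Finset.range m, {ω | Y k ω < -b}) +
        P.real {ω | ∑ k ∈ Finset.range m, Y' k ω ≤ 0} := measureReal_union_le _ _
    _ ≤ m * (N * b ^ (-(3 + δ))) + Real.exp (κ ^ 2 * σ * 16) * (m : ℝ) ^ (-(2 + δ)) := by
        refine add_le_add ?_ hchern
        refine (measureReal_biUnion_finset_le _ _).trans ?_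
        refine (Finset.sum_le_sum fun k _ => hjump k).trans ?_
        simp
    _ = _ := by
        have : (m : ℝ) ^ (-(2 + δ)) = m * (m : ℝ) ^ (-(3 + δ)) := by
          rw [show -(2 + δ) = 1 + -(3 + δ) by ring, Real.rpow_add hm0, Real.rpow_one]
        rw [hb, Real.mul_rpow ha0.le hm0.le, this]
        ring

end LowerDeviation

/-! ### Killed and stopped means for a general domain -/

section Killed

/-- `V` is a nonnegative function of linear growth, larger than `|y|`, that is superharmonic on the
positive half-line for the first coordinate of a walk with step law `μ`. -/
structure IsSuperharmonicMajorant (μ : Measure (ℝ × ℝ)) (V : ℝ → ℝ) (C : ℝ) : Prop where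
  nonneg_const : 0 ≤ C
  measurable : Measurable V
  abs_le : ∀ y, |y| ≤ V y
  le_linear : ∀ y, V y ≤ C * (1 + |y|)
  superharmonic : ∀ y, 0 < y → ∫ z, V (y + z.1) ∂μ ≤ V y

/-- The function `x ↦ x₁ - E(x₁ + S₁(τ_x) ; τ_x < ∞)` for the exit time from a general set. -/
noncomputable def domainFun {Ω : Type*} [MeasurableSpace Ω] (P : Measure Ω)
    (X : ℕ → Ω → ℝ × ℝ) (D : Set (ℝ × ℝ)) (x : ℝ × ℝ) : ℝ :=
  x.1 - ∫ ω in exitEvent X D x, (exitPosition X D x ω).1 ∂P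

/-- The mean of `f` at time `n` over the walks which have not left `D`. -/
noncomputable def killedMean {Ω : Type*} [MeasurableSpace Ω] (P : Measure Ω)
    (X : ℕ → Ω → ℝ × ℝ) (D : Set (ℝ × ℝ)) (f : ℝ × ℝ → ℝ) (n : ℕ) (x : ℝ × ℝ) : ℝ :=
  ∫ ω in survivalSet X D x n, f (walkFrom X x n ω) ∂P

/-- The mean of `f` along the walk stopped on leaving `D`. -/
noncomputable def stoppedMean {Ω : Type*} [MeasurableSpace Ω] (P : Measure Ω)
    (X : ℕ → Ω → ℝ × ℝ) (D : Set (ℝ × ℝ)) (f : ℝ × ℝ → ℝ) (n : ℕ) (x : ℝ × ℝ) : ℝ :=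
  killedMean P X D f n x + ∫ ω in (survivalSet X D x n)ᶜ, f (exitPosition X D x ω) ∂P

/-- The transition operator of the walk killed on leaving `D`. -/
noncomputable def killedStep (μ : Measure (ℝ × ℝ)) (D : Set (ℝ × ℝ)) (f : ℝ × ℝ → ℝ)
    (y : ℝ × ℝ) : ℝ :=
  ∫ z, D.indicator f (y + z) ∂μ

variable {Ω : Type*} [MeasurableSpace Ω] {P : Measure Ω}
  {X : ℕ → Ω → ℝ × ℝ} {D : Set (ℝ × ℝ)} {x : ℝ × ℝ} {f : ℝ × ℝ → ℝ} {V : ℝ → ℝ} {C : ℝ} {n : ℕ}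

lemma integrable_increment_fst (hident : ∀ n, IdentDistrib (X n) (X 0) P P)
    (hi : Integrable (fun ω => (X 0 ω).1) P) (n : ℕ) : Integrable (fun ω => (X n ω).1) P :=
  ((hident n).comp measurable_fst).integrable_iff.2 hi

lemma integral_fst_map (hX : ∀ n, Measurable (X n)) :
    ∫ z, z.1 ∂(P.map (X 0)) = ∫ ω, (X 0 ω).1 ∂P := by
  rw [integral_map (hX 0).aemeasurable measurable_fst.aestronglyMeasurable]

lemma integrable_fst_map (hX : ∀ n, Measurable (X n))
    (hi : Integrable (fun ω => (X 0 ω).1) P) :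
    Integrable (fun z : ℝ × ℝ => z.1) (P.map (X 0)) := by
  rw [integrable_map_measure measurable_fst.aestronglyMeasurable (hX 0).aemeasurable]
  exact hi

variable [IsProbabilityMeasure P]

lemma integrable_walkFrom_fst (hident : ∀ n, IdentDistrib (X n) (X 0) P P)
    (hi : Integrable (fun ω => (X 0 ω).1) P) :
    Integrable (fun ω => (walkFrom X x n ω).1) P := by
  simp only [walkFrom_fst]
  exact (integrable_const _).add
    (integrable_finsetSum _ fun k _ => integrable_increment_fst hident hi k)

lemma integrable_comp_of_linear {W : Ω → ℝ × ℝ} (hW : Measurable W)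
    (hi : Integrable (fun ω => (W ω).1) P) (hf : Measurable f)
    (hgrow : ∀ y, |f y| ≤ C * (1 + |y.1|)) : Integrable (fun ω => f (W ω)) P :=
  Integrable.mono' (((integrable_const 1).add hi.abs).const_mul C)
    (hf.comp hW).aestronglyMeasurable (Eventually.of_forall fun ω => hgrow (W ω))

lemma integrable_comp_walkFrom (hX : ∀ n, Measurable (X n))
    (hident : ∀ n, IdentDistrib (X n) (X 0) P P)
    (hi : Integrable (fun ω => (X 0 ω).1) P) (hf : Measurable f)
    (hgrow : ∀ y, |f y| ≤ C * (1 + |y.1|)) : Integrable (fun ω => f (walkFrom X x n ω)) P :=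
  integrable_comp_of_linear (measurable_walkFrom hX) (integrable_walkFrom_fst hident hi) hf hgrow

omit [IsProbabilityMeasure P] in
lemma integrableOn_exitPosition (hX : ∀ n, Measurable (X n)) (hD : MeasurableSet D)
    (hf : ∀ n, Integrable (fun ω => f (walkFrom X x n ω)) P) (n : ℕ) :
    IntegrableOn (fun ω => f (exitPosition X D x ω)) (survivalSet X D x n)ᶜ P := by
  induction n with
  | zero => simp [survivalSet_zero]
  | succ n ih =>
    rw [survivalSet_compl_succ]
    refine ih.union ?_
    refine (hf (n + 1)).integrableOn.congr_fun (fun ω hω => ?_)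
      (MeasurableSet.diff (measurableSet_survivalSet hX hD) (measurableSet_survivalSet hX hD))
    simp only [exitPosition_eq hω]

lemma stoppedMean_zero : stoppedMean P X D f 0 x = f x := by
  simp [stoppedMean, killedMean, survivalSet_zero, walkFrom_zero]

omit [IsProbabilityMeasure P] in
lemma setIntegral_survivalSet_split (hX : ∀ n, Measurable (X n)) (hD : MeasurableSet D)
    (hf : ∀ n, Integrable (fun ω => f (walkFrom X x n ω)) P) (n : ℕ) :
    ∫ ω in survivalSet X D x n, f (walkFrom X x (n + 1) ω) ∂P =
      killedMean P X D f (n + 1) x +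
      ∫ ω in survivalSet X D x n \ survivalSet X D x (n + 1), f (walkFrom X x (n + 1) ω) ∂P := by
  have h := setIntegral_union (μ := P) (f := fun ω => f (walkFrom X x (n + 1) ω))
    (Set.disjoint_sdiff_right (s := survivalSet X D x (n + 1)) (t := survivalSet X D x n))
    (MeasurableSet.diff (measurableSet_survivalSet hX hD) (measurableSet_survivalSet hX hD))
    (hf (n + 1)).integrableOn (hf (n + 1)).integrableOn
  rw [Set.union_sdiff_cancel (survivalSet_antitone (Nat.le_succ n))] at h
  exact h

omit [IsProbabilityMeasure P] in
-- Paths that have already left are frozen, so only the surviving ones move; those leaving at time n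
-- + 1 exit at their current position.
lemma stoppedMean_succ (hX : ∀ n, Measurable (X n)) (hD : MeasurableSet D)
    (hf : ∀ n, Integrable (fun ω => f (walkFrom X x n ω)) P) (n : ℕ) :
    stoppedMean P X D f (n + 1) x =
      ∫ ω in survivalSet X D x n, f (walkFrom X x (n + 1) ω) ∂P +
        ∫ ω in (survivalSet X D x n)ᶜ, f (exitPosition X D x ω) ∂P := by
  have hm : MeasurableSet (survivalSet X D x n \ survivalSet X D x (n + 1)) :=
    MeasurableSet.diff (measurableSet_survivalSet hX hD) (measurableSet_survivalSet hX hD)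
  have hint := integrableOn_exitPosition hX hD hf (n + 1)
  rw [survivalSet_compl_succ] at hint
  rw [setIntegral_survivalSet_split hX hD hf, stoppedMean, survivalSet_compl_succ,
    setIntegral_union disjoint_survival_compl_sdiff hm hint.left_of_union hint.right_of_union]
  have : ∫ ω in survivalSet X D x n \ survivalSet X D x (n + 1), f (exitPosition X D x ω) ∂P =
      ∫ ω in survivalSet X D x n \ survivalSet X D x (n + 1), f (walkFrom X x (n + 1) ω) ∂P :=
    setIntegral_congr_fun hm fun ω hω => by simp only [exitPosition_eq hω]
  rw [this]
  ring

lemma IsSuperharmonicMajorant.abs_growth {μ : Measure (ℝ × ℝ)}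
    (hV : IsSuperharmonicMajorant μ V C) (y : ℝ × ℝ) : |V y.1| ≤ C * (1 + |y.1|) := by
  rw [abs_of_nonneg ((abs_nonneg _).trans (hV.abs_le _))]
  exact hV.le_linear _

lemma IsSuperharmonicMajorant.nonneg {μ : Measure (ℝ × ℝ)}
    (hV : IsSuperharmonicMajorant μ V C) (y : ℝ) : 0 ≤ V y :=
  (abs_nonneg _).trans (hV.abs_le _)

lemma IsSuperharmonicMajorant.integrable_walk (hX : ∀ n, Measurable (X n))
    (hident : ∀ n, IdentDistrib (X n) (X 0) P P) (hi : Integrable (fun ω => (X 0 ω).1) P)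
    (hV : IsSuperharmonicMajorant (P.map (X 0)) V C) (n : ℕ) :
    Integrable (fun ω => V (walkFrom X x n ω).1) P :=
  integrable_comp_walkFrom hX hident hi (f := fun y => V y.1)
    (hV.measurable.comp measurable_fst) hV.abs_growth

/-- The superharmonic majorant decreases on average along one step of the walk, on every event of
the past on which the first coordinate is positive. -/
lemma IsSuperharmonicMajorant.setIntegral_succ_le (hX : ∀ n, Measurable (X n))
    (hindep : iIndepFun X P) (hident : ∀ n, IdentDistrib (X n) (X 0) P P)
    (hi : Integrable (fun ω => (X 0 ω).1) P)
    (hV : IsSuperharmonicMajorant (P.map (X 0)) V C) {A : Set Ω}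
    (hA : MeasurableSet[pastAlgebra X n] A) (hpos : ∀ ω ∈ A, 0 < (walkFrom X x n ω).1) :
    ∫ ω in A, V (walkFrom X x (n + 1) ω).1 ∂P ≤ ∫ ω in A, V (walkFrom X x n ω).1 ∂P := by
  have h := setIntegral_walkFrom_succ hX hindep hident (f := fun y => V y.1)
    (hV.measurable.comp measurable_fst) (hV.integrable_walk hX hident hi (x := x) (n + 1)) hA
  rw [h.2]
  refine setIntegral_mono_on h.1 (hV.integrable_walk hX hident hi n).integrableOn
    (pastAlgebra_le hX _ hA) fun ω hω => ?_
  exact hV.superharmonic _ (hpos ω hω)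

/-! ### Optional stopping, limits and harmonicity -/

section Domain

variable (hX : ∀ n, Measurable (X n)) (hindep : iIndepFun X P)
  (hident : ∀ n, IdentDistrib (X n) (X 0) P P) (hi : Integrable (fun ω => (X 0 ω).1) P)
  (hD : MeasurableSet D) (hDpos : ∀ y ∈ D, 0 < y.1)
include hX hindep hident hi hD

lemma stoppedMean_fst (hmean : ∫ ω, (X 0 ω).1 ∂P = 0) (n : ℕ) :
    stoppedMean P X D Prod.fst n x = x.1 := by
  have hint : ∀ n, Integrable (fun ω => (walkFrom X x n ω).1) P := fun n =>
    integrable_walkFrom_fst hident hi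
  have : IsProbabilityMeasure (P.map (X 0)) :=
    Measure.isProbabilityMeasure_map (hX 0).aemeasurable
  induction n with
  | zero => exact stoppedMean_zero
  | succ n ih =>
    rw [stoppedMean_succ hX hD hint, (setIntegral_walkFrom_succ hX hindep hident measurable_fst
      (hint (n + 1)) (measurableSet_survivalSet_past x hD)).2, ← ih, stoppedMean, killedMean]
    congr 2
    ext ω
    simp only [Prod.fst_add]
    rw [integral_add (integrable_const _) (integrable_fst_map hX hi), integral_fst_map hX, hmean]
    simp

include hDpos in
lemma stoppedMean_majorant_le (hV : IsSuperharmonicMajorant (P.map (X 0)) V C) (hx : x ∈ D)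
    (n : ℕ) : stoppedMean P X D (fun y => V y.1) n x ≤ V x.1 := by
  have hint := hV.integrable_walk hX hident hi (x := x)
  induction n with
  | zero => exact stoppedMean_zero.le
  | succ n ih =>
    rw [stoppedMean_succ (f := fun y => V y.1) hX hD hint]
    refine le_trans ?_ ih
    refine add_le_add_left (hV.setIntegral_succ_le hX hindep hident hi
      (measurableSet_survivalSet_past x hD) fun ω hω => ?_) _
    exact hDpos _ (walkFrom_mem_of_survival hx hω)

include hDpos in
-- The stopped mean of V bounds the absolute exit position on each event τ ≤ n, uniformly in n;
-- these events increase to τ < ∞.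
lemma integrableOn_exitPosition_fst (hV : IsSuperharmonicMajorant (P.map (X 0)) V C)
    (hx : x ∈ D) :
    IntegrableOn (fun ω => (exitPosition X D x ω).1) (exitEvent X D x) P := by
  have hint : ∀ n, IntegrableOn (fun ω => (exitPosition X D x ω).1) (survivalSet X D x n)ᶜ P :=
    integrableOn_exitPosition hX hD fun n => integrable_walkFrom_fst hident hi
  have hintV := integrableOn_exitPosition (f := fun y => V y.1) hX hD
    (hV.integrable_walk hX hident hi (x := x))
  rw [exitEvent_eq]
  refine ⟨aestronglyMeasurable_iUnion_iff.2 fun n => (hint n).1, ?_⟩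
  rw [hasFiniteIntegral_iff_enorm, setLIntegral_iUnion_of_directed]
  · refine lt_of_le_of_lt (iSup_le fun n => ?_) (ENNReal.ofReal_lt_top (r := V x.1))
    rw [← ofReal_integral_norm_eq_lintegral_enorm (hint n)]
    refine ENNReal.ofReal_le_ofReal ?_
    refine le_trans ?_ (stoppedMean_majorant_le hX hindep hident hi hD hDpos hV hx n)
    refine le_trans (integral_mono (hint n).norm (hintV n) fun ω => hV.abs_le _) ?_
    exact le_add_of_nonneg_left (integral_nonneg fun ω => hV.nonneg _)
  · exact Monotone.directed_le fun m n hmn =>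
      Set.compl_subset_compl.2 (survivalSet_antitone hmn)

include hDpos in
-- The stopped mean is constantly x₁, so the killed mean is x₁ minus an integral over τ ≤ n, which
-- converges by integrability of the exit position.
lemma tendsto_killedMean_fst (hmean : ∫ ω, (X 0 ω).1 ∂P = 0)
    (hV : IsSuperharmonicMajorant (P.map (X 0)) V C) (hx : x ∈ D) :
    Tendsto (fun n => killedMean P X D Prod.fst n x) atTop (𝓝 (domainFun P X D x)) := by
  have h := integrableOn_exitPosition_fst hX hindep hident hi hD hDpos hV hx
  rw [exitEvent_eq] at h
  have h2 := tendsto_setIntegral_of_monotone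
    (fun n => (measurableSet_survivalSet hX hD).compl)
    (fun m n hmn => Set.compl_subset_compl.2 (survivalSet_antitone hmn)) h
  rw [← exitEvent_eq] at h2
  refine (h2.const_sub x.1).congr fun n => ?_
  rw [← stoppedMean_fst (x := x) hX hindep hident hi hD hmean n, stoppedMean]
  ring

omit [IsProbabilityMeasure P] hindep hident hi in
include hDpos in
lemma killedMean_fst_nonneg (hx : x ∈ D) (n : ℕ) : 0 ≤ killedMean P X D Prod.fst n x :=
  setIntegral_nonneg (measurableSet_survivalSet hX hD) fun _ hω =>
    (hDpos _ (walkFrom_mem_of_survival hx hω)).le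

include hDpos in
lemma killedMean_fst_le (hV : IsSuperharmonicMajorant (P.map (X 0)) V C) (hx : x ∈ D) (n : ℕ) :
    killedMean P X D Prod.fst n x ≤ V x.1 := by
  refine le_trans ?_ (stoppedMean_majorant_le hX hindep hident hi hD hDpos hV hx n)
  refine le_trans (integral_mono (integrable_walkFrom_fst hident hi).integrableOn
    (hV.integrable_walk hX hident hi n).integrableOn
    fun ω => (le_abs_self _).trans (hV.abs_le _)) ?_
  exact le_add_of_nonneg_right (integral_nonneg fun ω => hV.nonneg _)

include hDpos in
lemma domainFun_nonneg (hmean : ∫ ω, (X 0 ω).1 ∂P = 0)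
    (hV : IsSuperharmonicMajorant (P.map (X 0)) V C) (hx : x ∈ D) : 0 ≤ domainFun P X D x :=
  ge_of_tendsto' (tendsto_killedMean_fst hX hindep hident hi hD hDpos hmean hV hx)
    (killedMean_fst_nonneg hX hD hDpos hx)

lemma killedMean_succ (hf : Measurable f) (hgrow : ∀ y, |f y| ≤ C * (1 + |y.1|)) (n : ℕ) :
    killedMean P X D f (n + 1) x = killedMean P X D (killedStep (P.map (X 0)) D f) n x := by
  have hg : ∀ y, |D.indicator f y| ≤ C * (1 + |y.1|) := fun y => by
    by_cases hy : y ∈ D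
    · simpa [hy] using hgrow y
    · simpa [hy] using (abs_nonneg _).trans (hgrow y)
  have h := (setIntegral_walkFrom_succ hX hindep hident (hf.indicator hD)
    (integrable_comp_walkFrom hX hident hi (hf.indicator hD) hg (x := x) (n := n + 1))
    (measurableSet_survivalSet_past x hD)).2
  refine Eq.trans ?_ h
  rw [killedMean, ← integral_indicator (measurableSet_survivalSet hX hD),
    ← integral_indicator (measurableSet_survivalSet hX hD)]
  congr 1
  ext ω
  have := mem_survivalSet_succ (X := X) (D := D) (x := x) (n := n) (ω := ω)
  by_cases h1 : ω ∈ survivalSet X D x n <;> by_cases h2 : walkFrom X x (n + 1) ω ∈ D <;>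
    simp [Set.indicator, this, h1, h2]

omit hindep hident in
lemma killedStep_measurable_growth (hf : Measurable f) (hgrow : ∀ y, |f y| ≤ C * (1 + |y.1|)) :
    Measurable (killedStep (P.map (X 0)) D f) ∧
      ∃ C', ∀ y, |killedStep (P.map (X 0)) D f y| ≤ C' * (1 + |y.1|) := by
  have : IsProbabilityMeasure (P.map (X 0)) :=
    Measure.isProbabilityMeasure_map (hX 0).aemeasurable
  have hC : 0 ≤ C := by
    have := (abs_nonneg _).trans (hgrow 0)
    simpa using this
  have hfst := integrable_fst_map hX hi
  constructor
  · have : Measurable fun p : (ℝ × ℝ) × (ℝ × ℝ) => D.indicator f (p.1 + p.2) :=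
      (hf.indicator hD).comp (measurable_fst.add measurable_snd)
    exact this.stronglyMeasurable.integral_prod_right.measurable
  · set M := ∫ z : ℝ × ℝ, |z.1| ∂(P.map (X 0))
    have hM : 0 ≤ M := integral_nonneg fun z => abs_nonneg _
    refine ⟨C * (1 + M), fun y => ?_⟩
    have hb : Integrable (fun z : ℝ × ℝ => C * (1 + |y.1| + |z.1|)) (P.map (X 0)) :=
      ((integrable_const _).add hfst.abs).const_mul C
    calc |killedStep (P.map (X 0)) D f y|
        ≤ ∫ z, |D.indicator f (y + z)| ∂(P.map (X 0)) := abs_integral_le_integral_abs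
      _ ≤ ∫ z : ℝ × ℝ, C * (1 + |y.1| + |z.1|) ∂(P.map (X 0)) := by
          refine integral_mono_of_nonneg (Eventually.of_forall fun z => abs_nonneg _) hb
            (Eventually.of_forall fun z => ?_)
          have h1 : |(y + z).1| ≤ |y.1| + |z.1| := abs_add_le _ _
          have h2 : C * (1 + |(y + z).1|) ≤ C * (1 + |y.1| + |z.1|) :=
            mul_le_mul_of_nonneg_left (by linarith) hC
          simp only
          by_cases hy : y + z ∈ D
          · simpa [hy] using (hgrow (y + z)).trans h2
          · simp only [hy, not_false_eq_true, Set.indicator_of_notMem, abs_zero]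
            positivity
      _ = C * (1 + |y.1| + M) := by
          rw [integral_const_mul, integral_add (integrable_const _) hfst.abs]
          simp [M]
      _ ≤ _ := by nlinarith [abs_nonneg y.1, mul_nonneg hM (abs_nonneg y.1)]

/-- The recursion at the last step exhibits powers of one operator. A power can equally be unfolded
from the outside, which is the decomposition at the first step that harmonicity needs. Measurability
in the starting point comes along. -/
lemma killedMean_eq_iterate (hf : Measurable f) (hgrow : ∀ y, |f y| ≤ C * (1 + |y.1|)) (n : ℕ) :
    Measurable ((killedStep (P.map (X 0)) D)^[n] f) ∧
      ∀ x, killedMean P X D f n x = (killedStep (P.map (X 0)) D)^[n] f x := by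
  induction n generalizing f C with
  | zero => exact ⟨hf, fun x => by simp [killedMean, survivalSet_zero, walkFrom_zero]⟩
  | succ n ih =>
    obtain ⟨h1, C', h2⟩ := killedStep_measurable_growth hX hi hD hf hgrow
    obtain ⟨h3, h4⟩ := ih h1 h2
    refine ⟨h3, fun x => ?_⟩
    rw [killedMean_succ hX hindep hident hi hD hf hgrow, h4, Function.iterate_succ_apply]

include hDpos in
-- The (n+1)-st killed mean is the average of the n-th over the first step. Both sides converge, the
-- average by domination with the integrable variable V(x₁ + X₁).
lemma isHarmonicKilled_domainFun (hmean : ∫ ω, (X 0 ω).1 ∂P = 0)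
    (hV : IsSuperharmonicMajorant (P.map (X 0)) V C) :
    IsHarmonicKilled P X D (domainFun P X D) := by
  intro x hx
  have hgrow : ∀ y : ℝ × ℝ, |y.1| ≤ 1 * (1 + |y.1|) := fun y => by linarith
  have hit := killedMean_eq_iterate hX hindep hident hi hD measurable_fst hgrow
  set F : ℕ → Ω → ℝ := fun n ω => D.indicator (fun y => killedMean P X D Prod.fst n y) (x + X 0 ω)
    with hF
  have hFm : ∀ n, AEStronglyMeasurable (F n) P := by
    intro n
    have h1 : (fun y => killedMean P X D Prod.fst n y) =
        (killedStep (P.map (X 0)) D)^[n] Prod.fst := funext (hit n).2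
    have h2 : Measurable (D.indicator fun y => killedMean P X D Prod.fst n y) := by
      rw [h1]
      exact (hit n).1.indicator hD
    exact (h2.comp (measurable_const.add (hX 0))).aestronglyMeasurable
  have hb : ∀ n, ∀ᵐ ω ∂P, ‖F n ω‖ ≤ V (x.1 + (X 0 ω).1) := by
    refine fun n => Eventually.of_forall fun ω => ?_
    by_cases hy : x + X 0 ω ∈ D
    · simp only [hF, hy, Set.indicator_of_mem]
      rw [Real.norm_of_nonneg (killedMean_fst_nonneg hX hD hDpos hy n)]
      exact killedMean_fst_le hX hindep hident hi hD hDpos hV hy n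
    · simp only [hF, hy, not_false_eq_true, Set.indicator_of_notMem, norm_zero]
      exact hV.nonneg _
  have hbi : Integrable (fun ω => V (x.1 + (X 0 ω).1)) P := by
    have := hV.integrable_walk hX hident hi (x := x) 1
    simpa [walkFrom_one] using this
  have hlim : ∀ᵐ ω ∂P, Tendsto (fun n => F n ω) atTop
      (𝓝 (D.indicator (domainFun P X D) (x + X 0 ω))) := by
    refine Eventually.of_forall fun ω => ?_
    by_cases hy : x + X 0 ω ∈ D
    · simp only [hF, hy, Set.indicator_of_mem]
      exact tendsto_killedMean_fst hX hindep hident hi hD hDpos hmean hV hy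
    · simp [hF, hy]
  have hmeaslim := aestronglyMeasurable_of_tendsto_ae atTop hFm hlim
  have hboundlim : ∀ᵐ ω ∂P, ‖D.indicator (domainFun P X D) (x + X 0 ω)‖ ≤
      V (x.1 + (X 0 ω).1) := by
    filter_upwards [hlim, ae_all_iff.2 hb] with ω h1 h2
    exact le_of_tendsto' h1.norm h2
  have hintlim := Integrable.mono' hbi hmeaslim hboundlim
  have hconv := tendsto_integral_of_dominated_convergence _ hFm hbi hb hlim
  have hstep : ∀ n, ∫ ω, F n ω ∂P = killedMean P X D Prod.fst (n + 1) x := by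
    intro n
    have h1 : (fun y => killedMean P X D Prod.fst n y) =
        (killedStep (P.map (X 0)) D)^[n] Prod.fst := funext (hit n).2
    rw [(hit (n + 1)).2, Function.iterate_succ_apply', killedStep, integral_map (hX 0).aemeasurable]
    · simp only [hF, h1]
    · exact (((hit n).1.indicator hD).comp (measurable_const_add x)).aestronglyMeasurable
  have hval : ∫ ω, D.indicator (domainFun P X D) (x + X 0 ω) ∂P = domainFun P X D x := by
    refine tendsto_nhds_unique hconv ?_
    simp only [hstep]
    exact (tendsto_killedMean_fst hX hindep hident hi hD hDpos hmean hV hx).comp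
      (tendsto_add_atTop_nat 1)
  have hset : {ω | 1 < exitTime X D x ω} = survivalSet X D x 1 := by
    ext ω
    rw [← lt_exitTime_iff]
    simp
  have hind : ∀ ω, (survivalSet X D x 1).indicator
      (fun ω => domainFun P X D (walkFrom X x 1 ω)) ω =
      D.indicator (domainFun P X D) (x + X 0 ω) := by
    intro ω
    have := mem_survivalSet_succ (X := X) (D := D) (x := x) (n := 0) (ω := ω)
    simp only [survivalSet_zero, Set.mem_univ, true_and, zero_add, walkFrom_one] at this
    by_cases hy : x + X 0 ω ∈ D <;> simp [Set.indicator, this, hy, walkFrom_one]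
  have hm : MeasurableSet (survivalSet X D x 1) := measurableSet_survivalSet hX hD
  rw [hset, ← integrable_indicator_iff hm, ← integral_indicator hm]
  simp only [funext hind]
  exact ⟨hintlim, hval.symm⟩

end Domain

end Killed

/-! ### The half-plane and its comparison with the quadrant -/

section HalfPlane

/-- The open right half-plane. -/
def openHalfPlane : Set (ℝ × ℝ) := {x | 0 < x.1}

lemma measurableSet_openHalfPlane : MeasurableSet openHalfPlane :=
  measurableSet_lt measurable_const measurable_fst

lemma measurableSet_openQuadrant : MeasurableSet openQuadrant :=
  (measurableSet_lt measurable_const measurable_fst).inter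
    (measurableSet_lt measurable_const measurable_snd)

lemma openQuadrant_subset_openHalfPlane : openQuadrant ⊆ openHalfPlane := fun _ h => h.1

variable {Ω : Type*} {X : ℕ → Ω → ℝ × ℝ}

/-- Makes the one-dimensional problem an instance of the planar one, with an arbitrary second
coordinate. -/
lemma exitTime_fst (t s : ℝ) :
    exitTime (fun n ω => (X n ω).1) (Set.Ioi 0) t = exitTime X openHalfPlane (t, s) := by
  have h : ∀ (k : ℕ) (ω : Ω), walkFrom (fun n ω => (X n ω).1) t k ω ∈ (Set.Ioi (0 : ℝ))ᶜ ↔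
      walkFrom X (t, s) k ω ∈ openHalfPlaneᶜ := by
    intro k ω
    simp [openHalfPlane, walkFrom, Prod.fst_sum]
  ext1 ω
  simp only [exitTime, hittingAfter, h]
  classical
  exact if_congr (by simp only [h]) rfl rfl

lemma exitEvent_fst (t s : ℝ) :
    exitEvent (fun n ω => (X n ω).1) (Set.Ioi 0) t = exitEvent X openHalfPlane (t, s) := by
  simp only [exitEvent, exitTime_fst t s]

lemma exitPosition_fst (t s : ℝ) (ω : Ω) :
    exitPosition (fun n ω => (X n ω).1) (Set.Ioi 0) t ω =
      (exitPosition X openHalfPlane (t, s) ω).1 := by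
  simp only [exitPosition, stoppedValue, exitTime_fst t s, walkFrom, Prod.fst_add, Prod.fst_sum]

variable [MeasurableSpace Ω] {P : Measure Ω}

lemma halfLineFun_fst (t s : ℝ) :
    halfLineFun P (fun n ω => (X n ω).1) t = domainFun P X openHalfPlane (t, s) := by
  simp only [halfLineFun, domainFun, exitEvent_fst t s, exitPosition_fst t s]

variable [IsProbabilityMeasure P] {x : ℝ × ℝ} {V : ℝ → ℝ} {C : ℝ} {n : ℕ}

section Comparison

variable (hX : ∀ n, Measurable (X n)) (hindep : iIndepFun X P)
  (hident : ∀ n, IdentDistrib (X n) (X 0) P P) (hi : Integrable (fun ω => (X 0 ω).1) P)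
  (hmean : ∫ ω, (X 0 ω).1 ∂P = 0)
include hX hindep hident hi hmean

lemma domainFun_quadrant_le (hV : IsSuperharmonicMajorant (P.map (X 0)) V C)
    (hx : x ∈ openQuadrant) :
    domainFun P X openQuadrant x ≤ domainFun P X openHalfPlane x := by
  refine le_of_tendsto_of_tendsto'
    (tendsto_killedMean_fst hX hindep hident hi measurableSet_openQuadrant (fun y hy => hy.1)
      hmean hV hx)
    (tendsto_killedMean_fst hX hindep hident hi measurableSet_openHalfPlane (fun y hy => hy)
      hmean hV hx.1) fun n => ?_
  refine setIntegral_mono_set (integrable_walkFrom_fst hident hi).integrableOn ?_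
    (survivalSet_mono openQuadrant_subset_openHalfPlane).eventuallyLE
  refine (ae_restrict_iff' (measurableSet_survivalSet hX measurableSet_openHalfPlane)).2
    (Eventually.of_forall fun ω hω => ?_)
  exact (walkFrom_mem_of_survival (D := openHalfPlane) hx.1 hω).le

/-- A path leaving the half-plane has first coordinate at most 0, so discarding it can only raise
the mean of a martingale. -/
lemma killedMean_halfPlane_mono : Monotone fun n => killedMean P X openHalfPlane Prod.fst n x := by
  refine monotone_nat_of_le_succ fun n => ?_
  have hint : ∀ n, Integrable (fun ω => Prod.fst (walkFrom X x n ω)) P := fun n =>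
    integrable_walkFrom_fst hident hi
  have hD := measurableSet_openHalfPlane
  have h1 := stoppedMean_fst (x := x) hX hindep hident hi hD hmean n
  have h2 := stoppedMean_fst (x := x) hX hindep hident hi hD hmean (n + 1)
  rw [← h1, stoppedMean_succ hX hD hint, stoppedMean,
    setIntegral_survivalSet_split hX hD hint] at h2
  have h3 : ∫ ω in survivalSet X openHalfPlane x n \ survivalSet X openHalfPlane x (n + 1),
      (walkFrom X x (n + 1) ω).1 ∂P ≤ 0 := by
    refine setIntegral_nonpos (MeasurableSet.diff (measurableSet_survivalSet hX hD)
      (measurableSet_survivalSet hX hD)) fun ω hω => ?_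
    by_contra! hcon
    exact hω.2 (mem_survivalSet_succ.2 ⟨hω.1, hcon⟩)
  linarith

/-- The limit of an increasing sequence is compared with its terms at times 0 and 1. Together they
bound h₁ below by a multiple of 1 + x₁, also near the boundary. -/
lemma le_domainFun_halfPlane (hV : IsSuperharmonicMajorant (P.map (X 0)) V C)
    (hx : x ∈ openHalfPlane) :
    x.1 ≤ domainFun P X openHalfPlane x ∧
      ∫ ω, max (X 0 ω).1 0 ∂P ≤ domainFun P X openHalfPlane x := by
  have hmono := killedMean_halfPlane_mono (x := x) hX hindep hident hi hmean
  have hlim := tendsto_killedMean_fst hX hindep hident hi measurableSet_openHalfPlane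
    (fun y hy => hy) hmean hV hx
  constructor
  · refine le_trans (le_of_eq ?_) (hmono.ge_of_tendsto hlim 0)
    simp [killedMean, survivalSet_zero, walkFrom_zero]
  · refine le_trans ?_ (hmono.ge_of_tendsto hlim 1)
    have hm : MeasurableSet (survivalSet X openHalfPlane x 1) :=
      measurableSet_survivalSet hX measurableSet_openHalfPlane
    simp only [killedMean]
    rw [← integral_indicator hm]
    refine integral_mono hi.pos_part
      ((integrable_walkFrom_fst hident hi).indicator hm) fun ω => ?_
    have h0 : 0 < x.1 := hx
    have h1 := mem_survivalSet_succ (X := X) (D := openHalfPlane) (x := x) (n := 0) (ω := ω)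
    simp only [survivalSet_zero, Set.mem_univ, true_and, zero_add, walkFrom_one] at h1
    by_cases h : ω ∈ survivalSet X openHalfPlane x 1
    · have h2 : 0 < x.1 + (X 0 ω).1 := h1.1 h
      simp only [h, Set.indicator_of_mem, walkFrom_one, Prod.fst_add]
      exact max_le (by linarith) h2.le
    · have h2 : ¬ 0 < x.1 + (X 0 ω).1 := fun h3 => h (h1.2 h3)
      simp only [h, not_false_eq_true, Set.indicator_of_notMem]
      exact max_le (by linarith) le_rfl

end Comparison

/-- The event that the walk leaves the quadrant at time `n + 1` without leaving the half-plane. -/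
def lowerExit (X : ℕ → Ω → ℝ × ℝ) (x : ℝ × ℝ) (n : ℕ) : Set Ω :=
  survivalSet X openHalfPlane x (n + 1) ∩
    (survivalSet X openQuadrant x n \ survivalSet X openQuadrant x (n + 1))

omit [MeasurableSpace Ω] in
lemma lowerExit_subset :
    lowerExit X x n ⊆ {ω | ∑ k ∈ Finset.range (n + 1), (X k ω).2 ≤ -x.2} := by
  rintro ω ⟨h1, h2, h3⟩
  have h4 : 0 < (walkFrom X x (n + 1) ω).1 := h1 (n + 1) (by omega) le_rfl
  simp only [Set.mem_ofPred_eq]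
  by_contra! hcon
  refine h3 (mem_survivalSet_succ.2 ⟨h2, h4, ?_⟩)
  rw [walkFrom_snd]
  linarith

lemma measurableSet_lowerExit (hX : ∀ n, Measurable (X n)) : MeasurableSet (lowerExit X x n) :=
  (measurableSet_survivalSet hX measurableSet_openHalfPlane).inter
    (MeasurableSet.diff (measurableSet_survivalSet hX measurableSet_openQuadrant)
      (measurableSet_survivalSet hX measurableSet_openQuadrant))

/-- The difference lives on paths that have left the quadrant but not the half-plane. On them V
dominates the first coordinate and decreases on average, so only its value when a path joins this
set counts. -/
lemma killedMean_sub_le (hX : ∀ n, Measurable (X n)) (hindep : iIndepFun X P)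
    (hident : ∀ n, IdentDistrib (X n) (X 0) P P) (hi : Integrable (fun ω => (X 0 ω).1) P)
    (hV : IsSuperharmonicMajorant (P.map (X 0)) V C) (hx : x ∈ openQuadrant) (n : ℕ) :
    killedMean P X openHalfPlane Prod.fst n x - killedMean P X openQuadrant Prod.fst n x ≤
      ∑ k ∈ Finset.range n, ∫ ω in lowerExit X x k, V (walkFrom X x (k + 1) ω).1 ∂P := by
  have hintV := hV.integrable_walk hX hident hi (x := x)
  set A := survivalSet X openQuadrant x with hA
  set B := survivalSet X openHalfPlane x with hB
  have hAp : ∀ n, MeasurableSet[pastAlgebra X n] (A n) := fun n =>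
    measurableSet_survivalSet_past x measurableSet_openQuadrant
  have hBp : ∀ n, MeasurableSet[pastAlgebra X n] (B n) := fun n =>
    measurableSet_survivalSet_past x measurableSet_openHalfPlane
  have hAm : ∀ n, MeasurableSet (A n) := fun n => pastAlgebra_le hX _ (hAp n)
  have hBm : ∀ n, MeasurableSet (B n) := fun n => pastAlgebra_le hX _ (hBp n)
  have hsub : ∀ n, A n ⊆ B n := fun n => survivalSet_mono openQuadrant_subset_openHalfPlane
  have hkey : ∀ n, ∫ ω in B n \ A n, V (walkFrom X x n ω).1 ∂P ≤
      ∑ k ∈ Finset.range n, ∫ ω in lowerExit X x k, V (walkFrom X x (k + 1) ω).1 ∂P := by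
    intro n
    induction n with
    | zero => simp [hA, hB, survivalSet_zero]
    | succ n ih =>
      have hdisj : Disjoint (B n \ A n) (lowerExit X x n) :=
        Set.disjoint_left.2 fun ω h1 h2 => h1.2 h2.2.1
      -- Such a path had either left the quadrant by time n or leaves it exactly now.
      have hstep : ∫ ω in B (n + 1) \ A (n + 1), V (walkFrom X x (n + 1) ω).1 ∂P ≤
          ∫ ω in (B n \ A n) ∪ lowerExit X x n, V (walkFrom X x (n + 1) ω).1 ∂P := by
        refine setIntegral_mono_set (hintV (n + 1)).integrableOn
          (Eventually.of_forall fun ω => hV.nonneg _) (Eventually.of_forall fun ω hω => ?_)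
        have hBn : ω ∈ B n := survivalSet_antitone (Nat.le_succ n) hω.1
        by_cases h : ω ∈ A n
        · exact Or.inr ⟨hω.1, h, hω.2⟩
        · exact Or.inl ⟨hBn, h⟩
      rw [setIntegral_union hdisj (measurableSet_lowerExit hX) (hintV (n + 1)).integrableOn
        (hintV (n + 1)).integrableOn] at hstep
      have hsuper := hV.setIntegral_succ_le hX hindep hident hi (n := n) (x := x)
        (MeasurableSet.diff (hBp n) (hAp n)) fun ω hω =>
          walkFrom_mem_of_survival (D := openHalfPlane) hx.1 hω.1
      rw [Finset.sum_range_succ]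
      linarith
  have hint := integrable_walkFrom_fst hident hi (x := x) (n := n)
  refine le_trans (le_of_eq ?_) ((setIntegral_mono hint.integrableOn (hintV n).integrableOn
    fun ω => (le_abs_self _).trans (hV.abs_le _)).trans (hkey n))
  exact (setIntegral_sdiff (hAm n) hint.integrableOn (hsub n)).symm

/-! ### Second moment of the displacement at lower exits -/

section SecondMoment

variable (hX : ∀ n, Measurable (X n)) (hindep : iIndepFun X P)
  (hident : ∀ n, IdentDistrib (X n) (X 0) P P) (hL2 : MemLp (fun ω => (X 0 ω).1) 2 P)
include hident hL2

omit [IsProbabilityMeasure P] in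
lemma memLp_increment_fst (n : ℕ) : MemLp (fun ω => (X n ω).1) 2 P :=
  ((hident n).comp measurable_fst).memLp_iff.2 hL2

omit [IsProbabilityMeasure P] in
lemma integrable_sq_displacement (n : ℕ) :
    Integrable (fun ω => ((walkFrom X x n ω).1 - x.1) ^ 2) P := by
  have h : MemLp (fun ω => ∑ k ∈ Finset.range n, (X k ω).1) 2 P :=
    memLp_finsetSum _ fun k _ => memLp_increment_fst hident hL2 k
  refine h.integrable_sq.congr (Eventually.of_forall fun ω => ?_)
  simp [walkFrom_fst]

include hX hindep

lemma setIntegral_sq_displacement_succ (hmean : ∫ ω, (X 0 ω).1 ∂P = 0) {A : Set Ω}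
    (hA : MeasurableSet[pastAlgebra X n] A) :
    ∫ ω in A, ((walkFrom X x (n + 1) ω).1 - x.1) ^ 2 ∂P =
      ∫ ω in A, ((walkFrom X x n ω).1 - x.1) ^ 2 ∂P + (∫ ω, (X 0 ω).1 ^ 2 ∂P) * P.real A := by
  have hi : Integrable (fun ω => (X 0 ω).1) P := hL2.integrable (by norm_num)
  have hi1 := integrable_fst_map hX hi
  have hi2 : Integrable (fun z : ℝ × ℝ => z.1 ^ 2) (P.map (X 0)) := by
    rw [integrable_map_measure (measurable_fst.pow_const 2).aestronglyMeasurable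
      (hX 0).aemeasurable]
    exact hL2.integrable_sq
  have hprob : IsProbabilityMeasure (P.map (X 0)) :=
    Measure.isProbabilityMeasure_map (hX 0).aemeasurable
  have hσ : ∫ z : ℝ × ℝ, z.1 ^ 2 ∂(P.map (X 0)) = ∫ ω, (X 0 ω).1 ^ 2 ∂P := by
    rw [integral_map (hX 0).aemeasurable (measurable_fst.pow_const 2).aestronglyMeasurable]
  have hinner : ∀ y : ℝ × ℝ, ∫ z, ((y + z).1 - x.1) ^ 2 ∂(P.map (X 0)) =
      (y.1 - x.1) ^ 2 + ∫ ω, (X 0 ω).1 ^ 2 ∂P := by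
    intro y
    have h1 : ∀ z : ℝ × ℝ, ((y + z).1 - x.1) ^ 2 =
        (y.1 - x.1) ^ 2 + 2 * (y.1 - x.1) * z.1 + z.1 ^ 2 := fun z => by
      simp only [Prod.fst_add]
      ring
    have h2 : Integrable (fun z : ℝ × ℝ => (y.1 - x.1) ^ 2 + 2 * (y.1 - x.1) * z.1)
        (P.map (X 0)) := (integrable_const _).add (hi1.const_mul _)
    simp only [h1]
    rw [integral_add h2 hi2, integral_add (integrable_const _) (hi1.const_mul _),
      integral_const_mul, integral_fst_map hX, hmean, hσ]
    simp
  rw [(setIntegral_walkFrom_succ hX hindep hident (f := fun y => (y.1 - x.1) ^ 2) (by fun_prop)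
    (integrable_sq_displacement hident hL2 (n + 1)) hA).2]
  simp only [hinner]
  rw [integral_add (integrable_sq_displacement hident hL2 n).integrableOn
    (integrable_const _)]
  simp [mul_comm]

lemma sum_setIntegral_sq_displacement_le (hmean : ∫ ω, (X 0 ω).1 ∂P = 0) {w : ℕ → ℝ}
    (hw : Monotone w) (hw0 : ∀ n, 0 < w n) (n : ℕ) :
    ∑ k ∈ Finset.range n, (∫ ω in lowerExit X x k, ((walkFrom X x (k + 1) ω).1 - x.1) ^ 2 ∂P) /
      w (k + 1) ≤ (∫ ω, (X 0 ω).1 ^ 2 ∂P) * ∑ k ∈ Finset.range n, 1 / w (k + 1) := by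
  have hint := integrable_sq_displacement (x := x) hident hL2
  have hD := measurableSet_openQuadrant
  set σ := ∫ ω, (X 0 ω).1 ^ 2 ∂P with hσ
  have hσ0 : 0 ≤ σ := integral_nonneg fun ω => sq_nonneg _
  have hnn : ∀ (S : Set Ω) k, 0 ≤ ∫ ω in S, ((walkFrom X x k ω).1 - x.1) ^ 2 ∂P := fun S k =>
    integral_nonneg fun ω => sq_nonneg _
  -- The induction must carry the second moment of the surviving walk. A step adds at most σ to it,
  -- a lower exit takes its share away, and the increase of the weight only shrinks what is carried.
  have key : killedMean P X openQuadrant (fun y => (y.1 - x.1) ^ 2) n x / w n +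
      ∑ k ∈ Finset.range n, (∫ ω in lowerExit X x k, ((walkFrom X x (k + 1) ω).1 - x.1) ^ 2 ∂P) /
        w (k + 1) ≤ σ * ∑ k ∈ Finset.range n, 1 / w (k + 1) := by
    induction n with
    | zero => simp [killedMean, survivalSet_zero, walkFrom_zero]
    | succ n ih =>
      have h1 := setIntegral_survivalSet_split (x := x) (f := fun y => (y.1 - x.1) ^ 2) hX hD hint n
      rw [setIntegral_sq_displacement_succ hX hindep hident hL2 hmean
        (measurableSet_survivalSet_past x hD)] at h1
      have h2 : ∫ ω in lowerExit X x n, ((walkFrom X x (n + 1) ω).1 - x.1) ^ 2 ∂P ≤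
          ∫ ω in survivalSet X openQuadrant x n \ survivalSet X openQuadrant x (n + 1),
            ((walkFrom X x (n + 1) ω).1 - x.1) ^ 2 ∂P :=
        setIntegral_mono_set (hint (n + 1)).integrableOn
          (Eventually.of_forall fun ω => sq_nonneg _) Set.inter_subset_right.eventuallyLE
      have h3 : σ * P.real (survivalSet X openQuadrant x n) ≤ σ :=
        mul_le_of_le_one_right hσ0 measureReal_le_one
      set I := ∫ ω in lowerExit X x n, ((walkFrom X x (n + 1) ω).1 - x.1) ^ 2 ∂P
      set J := killedMean P X openQuadrant (fun y => (y.1 - x.1) ^ 2) (n + 1) x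
      have h4 : J + I ≤ killedMean P X openQuadrant (fun y => (y.1 - x.1) ^ 2) n x + σ := by
        have : ∫ ω in survivalSet X openQuadrant x n, ((walkFrom X x n ω).1 - x.1) ^ 2 ∂P =
          killedMean P X openQuadrant (fun y => (y.1 - x.1) ^ 2) n x := rfl
        linarith
      have h5 : J / w (n + 1) + I / w (n + 1) ≤
          killedMean P X openQuadrant (fun y => (y.1 - x.1) ^ 2) n x / w n +
            σ * (1 / w (n + 1)) := by
        rw [← add_div]
        refine (div_le_div_of_nonneg_right h4 (hw0 (n + 1)).le).trans ?_
        rw [add_div, mul_one_div]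
        gcongr
        · exact hnn _ _
        · exact hw0 n
        · exact hw (Nat.le_succ n)
      rw [Finset.sum_range_succ, Finset.sum_range_succ, mul_add]
      linarith
  have : 0 ≤ killedMean P X openQuadrant (fun y => (y.1 - x.1) ^ 2) n x / w n :=
    div_nonneg (hnn _ _) (hw0 n).le
  linarith

/-- The defect between the half-plane and the quadrant, in terms of the probabilities that the
second coordinate of the walk is below its starting point by `x₂`. -/
lemma domainFun_halfPlane_sub_le (hmean : ∫ ω, (X 0 ω).1 ∂P = 0)
    (hV : IsSuperharmonicMajorant (P.map (X 0)) V C) (hx : x ∈ openQuadrant) {w : ℕ → ℝ}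
    (hw : Monotone w) (hw1 : ∀ n, 1 ≤ w n) (hws : Summable fun k => 1 / w (k + 1))
    (hp : Summable fun k => w (k + 1) *
      P.real {ω | ∑ j ∈ Finset.range (k + 1), (X j ω).2 ≤ -x.2})
    {θ : ℝ} (hθ : 0 < θ) :
    domainFun P X openHalfPlane x - domainFun P X openQuadrant x ≤
      C * ((1 + x.1 + 1 / θ) * ∑' k, w (k + 1) *
          P.real {ω | ∑ j ∈ Finset.range (k + 1), (X j ω).2 ≤ -x.2} +
        θ * ((∫ ω, (X 0 ω).1 ^ 2 ∂P) * ∑' k, 1 / w (k + 1))) := by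
  have hi : Integrable (fun ω => (X 0 ω).1) P := hL2.integrable (by norm_num)
  have hw0 : ∀ n, 0 < w n := fun n => lt_of_lt_of_le one_pos (hw1 n)
  have hx1 : 0 < x.1 := hx.1
  set p : ℕ → ℝ := fun k => P.real {ω | ∑ j ∈ Finset.range (k + 1), (X j ω).2 ≤ -x.2} with hpdef
  set σ := ∫ ω, (X 0 ω).1 ^ 2 ∂P with hσ
  have hσ0 : 0 ≤ σ := integral_nonneg fun ω => sq_nonneg _
  have hp0 : ∀ k, 0 ≤ p k := fun k => measureReal_nonneg
  set I : ℕ → ℝ := fun k => ∫ ω in lowerExit X x k, ((walkFrom X x (k + 1) ω).1 - x.1) ^ 2 ∂P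
    with hI
  have hterm : ∀ k, ∫ ω in lowerExit X x k, V (walkFrom X x (k + 1) ω).1 ∂P ≤
      C * ((1 + x.1 + 1 / θ) * (w (k + 1) * p k) + θ * (I k / w (k + 1))) := by
    intro k
    have hint := integrable_sq_displacement (x := x) hident hL2 (k + 1)
    have hpt : ∀ ω, V (walkFrom X x (k + 1) ω).1 ≤
        C * ((1 + x.1 + w (k + 1) / θ) +
          θ / w (k + 1) * ((walkFrom X x (k + 1) ω).1 - x.1) ^ 2) := by
      intro ω
      refine (hV.le_linear _).trans (mul_le_mul_of_nonneg_left ?_ hV.nonneg_const)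
      set s := (walkFrom X x (k + 1) ω).1 - x.1 with hs
      have h1 : |(walkFrom X x (k + 1) ω).1| ≤ x.1 + |s| := by
        have := abs_add_le x.1 s
        rw [hs, add_sub_cancel, abs_of_pos hx1] at this
        exact this
      -- The threshold separating displacements charged to the probability from those charged to the
      -- second moment.
      set r := w (k + 1) / θ with hr
      have hr0 : 0 < r := div_pos (hw0 _) hθ
      have h2 : |s| ≤ r + s ^ 2 / r := by
        have h3 : 0 ≤ (|s| - r) ^ 2 + |s| * r := by positivity
        have h4 : |s| * r ≤ (r + s ^ 2 / r) * r := by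
          rw [add_mul, div_mul_cancel₀ _ hr0.ne', ← sq_abs s]
          nlinarith
        exact le_of_mul_le_mul_right h4 hr0
      have h5 : θ / w (k + 1) * s ^ 2 = s ^ 2 / r := by rw [hr]; field_simp
      linarith
    have hmeas : MeasurableSet (lowerExit X x k) := measurableSet_lowerExit hX
    have hP : P.real (lowerExit X x k) ≤ p k := measureReal_mono lowerExit_subset
    calc ∫ ω in lowerExit X x k, V (walkFrom X x (k + 1) ω).1 ∂P
        ≤ ∫ ω in lowerExit X x k, C * ((1 + x.1 + w (k + 1) / θ) +
          θ / w (k + 1) * ((walkFrom X x (k + 1) ω).1 - x.1) ^ 2) ∂P :=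
          setIntegral_mono (hV.integrable_walk hX hident hi (k + 1)).integrableOn
            (((integrable_const _).add (hint.const_mul _)).const_mul C).integrableOn hpt
      _ = C * ((1 + x.1 + w (k + 1) / θ) * P.real (lowerExit X x k) + θ / w (k + 1) * I k) := by
          rw [integral_const_mul, integral_add (integrable_const _)
            (hint.const_mul _).integrableOn, integral_const_mul]
          simp [hI, mul_comm]
      _ ≤ _ := by
          refine mul_le_mul_of_nonneg_left (add_le_add ?_ (le_of_eq (by ring))) hV.nonneg_const
          have h0 : 0 ≤ 1 + x.1 + w (k + 1) / θ := by
            have := hw0 (k + 1)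
            positivity
          refine (mul_le_mul_of_nonneg_left hP h0).trans ?_
          have h1 : 1 + x.1 ≤ (1 + x.1) * w (k + 1) :=
            le_mul_of_one_le_right (by linarith) (hw1 _)
          have h2 : 1 + x.1 + w (k + 1) / θ ≤ (1 + x.1 + 1 / θ) * w (k + 1) := by
            rw [add_mul (1 + x.1), one_div_mul_eq_div]
            linarith
          calc _ ≤ (1 + x.1 + 1 / θ) * w (k + 1) * p k :=
                mul_le_mul_of_nonneg_right h2 (hp0 k)
            _ = _ := by ring
  have hlim := (tendsto_killedMean_fst hX hindep hident hi measurableSet_openHalfPlane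
    (fun y hy => hy) hmean hV hx.1).sub
    (tendsto_killedMean_fst hX hindep hident hi measurableSet_openQuadrant (fun y hy => hy.1)
      hmean hV hx)
  refine le_of_tendsto' hlim fun n => ?_
  refine (killedMean_sub_le hX hindep hident hi hV hx n).trans ?_
  refine (Finset.sum_le_sum fun k _ => hterm k).trans ?_
  rw [← Finset.mul_sum, Finset.sum_add_distrib, ← Finset.mul_sum, ← Finset.mul_sum]
  refine mul_le_mul_of_nonneg_left (add_le_add ?_ ?_) hV.nonneg_const
  · refine mul_le_mul_of_nonneg_left ?_ (by positivity)
    exact hp.sum_le_tsum _ fun k _ => mul_nonneg (hw0 _).le (hp0 k)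
  · refine mul_le_mul_of_nonneg_left ?_ hθ.le
    refine (sum_setIntegral_sq_displacement_le hX hindep hident hL2 hmean hw hw0 n).trans ?_
    refine mul_le_mul_of_nonneg_left ?_ hσ0
    exact hws.sum_le_tsum _ fun k _ => one_div_nonneg.2 (hw0 _).le

end SecondMoment

end HalfPlane

/-! ### Asymptotics and positivity in the quadrant -/

section Quadrant

variable {Ω : Type*} [MeasurableSpace Ω] {P : Measure Ω} [IsProbabilityMeasure P]

lemma tendsto_measureReal_le_neg {Z : Ω → ℝ} (hZ : Measurable Z) :
    Tendsto (fun t : ℝ => P.real {ω | Z ω ≤ -t}) atTop (𝓝 0) := by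
  have : IsProbabilityMeasure (P.map Z) := Measure.isProbabilityMeasure_map hZ.aemeasurable
  refine ((tendsto_cdf_atBot (P.map Z)).comp tendsto_neg_atTop_atBot).congr fun t => ?_
  rw [Function.comp_apply, cdf_eq_real, map_measureReal_apply hZ measurableSet_Iic]
  rfl

/-- The weighted sum of the probabilities that a walk is below `-t` is finite and vanishes as
`t → ∞`, for weights which grow slower than these probabilities decay. -/
lemma tendsto_tsum_weighted_measure_le {Y : ℕ → Ω → ℝ} (hY : ∀ n, Measurable (Y n)) {K δ : ℝ}
    (hδ : 0 < δ) (hK : ∀ m : ℕ, 1 ≤ m →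
      P.real {ω | ∑ k ∈ Finset.range m, Y k ω ≤ 0} ≤ K * (m : ℝ) ^ (-(2 + δ))) :
    (∀ t : ℝ, 0 ≤ t → Summable fun k : ℕ => (((k + 1 : ℕ) : ℝ) + 1) ^ (1 + δ / 2) *
        P.real {ω | ∑ j ∈ Finset.range (k + 1), Y j ω ≤ -t}) ∧
    Tendsto (fun t : ℝ => ∑' k : ℕ, (((k + 1 : ℕ) : ℝ) + 1) ^ (1 + δ / 2) *
      P.real {ω | ∑ j ∈ Finset.range (k + 1), Y j ω ≤ -t}) atTop (𝓝 0) := by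
  set a : ℕ → ℝ := fun k => (2 : ℝ) ^ (1 + δ / 2) * K * ((k + 1 : ℕ) : ℝ) ^ (-(1 + δ / 2))
  have ha : Summable a :=
    ((summable_nat_add_iff 1).2 (Real.summable_nat_rpow.2
      (by linarith : -(1 + δ / 2) < -1))).mul_left _
  have hbound : ∀ t : ℝ, 0 ≤ t → ∀ k : ℕ, (((k + 1 : ℕ) : ℝ) + 1) ^ (1 + δ / 2) *
      P.real {ω | ∑ j ∈ Finset.range (k + 1), Y j ω ≤ -t} ≤ a k := by
    intro t ht k
    have hm : (1 : ℝ) ≤ ((k + 1 : ℕ) : ℝ) := by exact_mod_cast Nat.le_add_left 1 k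
    set m : ℝ := ((k + 1 : ℕ) : ℝ)
    have h1 : P.real {ω | ∑ j ∈ Finset.range (k + 1), Y j ω ≤ -t} ≤ K * m ^ (-(2 + δ)) :=
      (measureReal_mono fun ω (hω : _ ≤ -t) => show _ ≤ (0 : ℝ) by linarith).trans
        (hK (k + 1) (by omega))
    have h2 : (m + 1) ^ (1 + δ / 2) ≤ 2 ^ (1 + δ / 2) * m ^ (1 + δ / 2) := by
      rw [← Real.mul_rpow (by norm_num) (by linarith)]
      exact Real.rpow_le_rpow (by linarith) (by linarith) (by linarith)
    have h3 : m ^ (1 + δ / 2) * m ^ (-(2 + δ)) = m ^ (-(1 + δ / 2)) := by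
      rw [← Real.rpow_add (by linarith)]
      congr 1
      ring
    calc _ ≤ (2 ^ (1 + δ / 2) * m ^ (1 + δ / 2)) * (K * m ^ (-(2 + δ))) :=
          mul_le_mul h2 h1 measureReal_nonneg (by positivity)
      _ = 2 ^ (1 + δ / 2) * K * (m ^ (1 + δ / 2) * m ^ (-(2 + δ))) := by ring
      _ = a k := by rw [h3]
  have hnn : ∀ (t : ℝ) (k : ℕ), 0 ≤ (((k + 1 : ℕ) : ℝ) + 1) ^ (1 + δ / 2) *
      P.real {ω | ∑ j ∈ Finset.range (k + 1), Y j ω ≤ -t} := fun t k =>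
    mul_nonneg (by positivity) measureReal_nonneg
  refine ⟨fun t ht => Summable.of_nonneg_of_le (hnn t) (hbound t ht) ha, ?_⟩
  -- Each probability vanishes as t → ∞, and the bound at t = 0 dominates the series for all t ≥ 0.
  have h := tendsto_tsum_of_dominated_convergence (𝓕 := (atTop : Filter ℝ))
    (f := fun (t : ℝ) (k : ℕ) => (((k + 1 : ℕ) : ℝ) + 1) ^ (1 + δ / 2) *
      P.real {ω | ∑ j ∈ Finset.range (k + 1), Y j ω ≤ -t}) (g := fun _ => (0 : ℝ)) ha
    (fun k => ?_) ?_
  · simpa using h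
  · have := (tendsto_measureReal_le_neg (P := P)
      (Finset.measurable_fun_sum (Finset.range (k + 1)) fun j _ => hY j)).const_mul
      ((((k + 1 : ℕ) : ℝ) + 1) ^ (1 + δ / 2))
    simpa using this
  · filter_upwards [eventually_ge_atTop 0] with t ht k
    rw [Real.norm_of_nonneg (hnn t k)]
    exact hbound t ht k

variable {X : ℕ → Ω → ℝ × ℝ} {V : ℝ → ℝ} {C : ℝ}

/-- The function of the quadrant is asymptotic to that of the half-plane, uniformly in the first
coordinate, as the second coordinate tends to infinity. -/
lemma exists_abs_div_sub_one_lt (hX : ∀ n, Measurable (X n)) (hindep : iIndepFun X P)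
    (hident : ∀ n, IdentDistrib (X n) (X 0) P P) (hL2 : MemLp (fun ω => (X 0 ω).1) 2 P)
    (hmean : ∫ ω, (X 0 ω).1 ∂P = 0) (hpos : 0 < ∫ ω, max (X 0 ω).1 0 ∂P)
    (hV : IsSuperharmonicMajorant (P.map (X 0)) V C) {K δ : ℝ} (hδ : 0 < δ)
    (hK : ∀ m : ℕ, 1 ≤ m →
      P.real {ω | ∑ k ∈ Finset.range m, (X k ω).2 ≤ 0} ≤ K * (m : ℝ) ^ (-(2 + δ)))
    {ε : ℝ} (hε : 0 < ε) :
    ∃ b : ℝ, 0 < b ∧ ∀ x : ℝ × ℝ, b ≤ x.2 → 0 < x.1 →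
      |domainFun P X openQuadrant x / domainFun P X openHalfPlane x - 1| < ε := by
  have hi : Integrable (fun ω => (X 0 ω).1) P := hL2.integrable (by norm_num)
  set e := ∫ ω, max (X 0 ω).1 0 ∂P with he
  set w : ℕ → ℝ := fun n => ((n : ℝ) + 1) ^ (1 + δ / 2) with hw
  have hwmono : Monotone w := fun m n hmn => by
    have : (m : ℝ) ≤ n := by exact_mod_cast hmn
    exact Real.rpow_le_rpow (by positivity) (by linarith) (by linarith)
  have hw1 : ∀ n, 1 ≤ w n := fun n => by
    refine Real.one_le_rpow ?_ (by linarith)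
    have : (0 : ℝ) ≤ n := Nat.cast_nonneg n
    linarith
  have hws : Summable fun k => 1 / w (k + 1) := by
    have h := (summable_nat_add_iff 2).2 (Real.summable_nat_rpow.2
      (by linarith : -(1 + δ / 2) < -1))
    refine h.congr fun k => ?_
    rw [hw, one_div, ← Real.rpow_neg (by positivity)]
    congr 1
    push_cast
    ring
  obtain ⟨hsum, hq⟩ := tendsto_tsum_weighted_measure_le (P := P) (fun n => (hX n).snd) hδ hK
  set q : ℝ → ℝ := fun t => ∑' k : ℕ, (((k + 1 : ℕ) : ℝ) + 1) ^ (1 + δ / 2) *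
      P.real {ω | ∑ j ∈ Finset.range (k + 1), (X j ω).2 ≤ -t} with hqdef
  set σW := (∫ ω, (X 0 ω).1 ^ 2 ∂P) * ∑' k, 1 / w (k + 1) with hσW
  have hσW0 : 0 ≤ σW := mul_nonneg (integral_nonneg fun ω => sq_nonneg _)
    (tsum_nonneg fun k => one_div_nonneg.2 (zero_le_one.trans (hw1 _)))
  have hC := hV.nonneg_const
  -- Averaging the two lower bounds x₁ and e for the half-plane function gives c(1 + x₁).
  set c := min 1 e / 2 with hc
  have hc0 : 0 < c := half_pos (lt_min one_pos hpos)
  -- The order matters: θ is fixed before b, since the probability term carries the factor 1 + 1/θ.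
  obtain ⟨θ, hθ, hθε⟩ : ∃ θ : ℝ, 0 < θ ∧ C * (θ * σW) < ε * c / 2 := by
    refine ⟨ε * c / 2 / (C * σW + 1), by positivity, ?_⟩
    have h1 : 0 ≤ C * σW := by positivity
    rw [show C * (ε * c / 2 / (C * σW + 1) * σW) = ε * c / 2 * (C * σW) / (C * σW + 1) by ring,
      div_lt_iff₀ (by linarith)]
    have : 0 < ε * c / 2 := by positivity
    nlinarith
  have hlim : Tendsto (fun t => C * ((1 + 1 / θ) * q t)) atTop (𝓝 0) := by
    have := (hq.const_mul (1 + 1 / θ)).const_mul C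
    simpa using this
  obtain ⟨b, hb⟩ := eventually_atTop.1
    ((hlim.eventually (gt_mem_nhds (by positivity : 0 < ε * c / 2))).and (eventually_gt_atTop 0))
  refine ⟨max b 1, by positivity, fun x hx2 hx1 => ?_⟩
  obtain ⟨hb1, hb2⟩ := hb x.2 ((le_max_left _ _).trans hx2)
  have hx : x ∈ openQuadrant := ⟨hx1, hb2⟩
  have hdiff := domainFun_halfPlane_sub_le hX hindep hident hL2 hmean hV hx hwmono hw1 hws
    (hsum x.2 hb2.le) hθ
  have hle := domainFun_quadrant_le hX hindep hident hi hmean hV hx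
  obtain ⟨hg1, hg2⟩ := le_domainFun_halfPlane hX hindep hident hi hmean hV
    (openQuadrant_subset_openHalfPlane hx)
  set h := domainFun P X openQuadrant x
  set g := domainFun P X openHalfPlane x
  have hgc : c * (1 + x.1) ≤ g := by
    have h1 : min 1 e ≤ e := min_le_right _ _
    have h2 : min 1 e * x.1 ≤ x.1 := mul_le_of_le_one_left hx1.le (min_le_left _ _)
    rw [hc]
    linarith
  have hg0 : 0 < g := lt_of_lt_of_le (by positivity) hgc
  have hq0 : 0 ≤ q x.2 := tsum_nonneg fun k => mul_nonneg (by positivity) measureReal_nonneg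
  have hfin : g - h < ε * g := by
    have h1 : (1 + x.1 + 1 / θ) * q x.2 ≤ (1 + x.1) * ((1 + 1 / θ) * q x.2) := by
      have : 0 ≤ x.1 * (1 / θ) * q x.2 := by positivity
      nlinarith
    have h2 : θ * σW ≤ (1 + x.1) * (θ * σW) :=
      le_mul_of_one_le_left (by positivity) (by linarith)
    have h3 : g - h ≤ C * ((1 + x.1) * ((1 + 1 / θ) * q x.2) + (1 + x.1) * (θ * σW)) :=
      hdiff.trans (mul_le_mul_of_nonneg_left (add_le_add h1 h2) hC)
    have h4 : C * ((1 + x.1) * ((1 + 1 / θ) * q x.2) + (1 + x.1) * (θ * σW)) =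
        (1 + x.1) * (C * ((1 + 1 / θ) * q x.2) + C * (θ * σW)) := by ring
    have h5 : (1 + x.1) * (C * ((1 + 1 / θ) * q x.2) + C * (θ * σW)) < (1 + x.1) * (ε * c) :=
      mul_lt_mul_of_pos_left (by linarith) (by linarith)
    have h6 := mul_le_mul_of_nonneg_left hgc hε.le
    linarith
  have habs : h / g - 1 = -((g - h) / g) := by
    field_simp
    ring
  rw [habs, abs_neg, abs_of_nonneg (div_nonneg (by linarith) hg0.le), div_lt_iff₀ hg0]
  exact hfin

omit [IsProbabilityMeasure P] in
lemma exists_pos_measure_gt {Z : Ω → ℝ × ℝ} (h : 0 < P {ω | Z ω ∈ openQuadrant}) :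
    ∃ κ : ℝ, 0 < κ ∧ 0 < P {ω | 0 < (Z ω).1 ∧ κ < (Z ω).2} := by
  by_contra! hcon
  have hsub : {ω | Z ω ∈ openQuadrant} ⊆
      ⋃ n : ℕ, {ω | 0 < (Z ω).1 ∧ 1 / ((n : ℝ) + 1) < (Z ω).2} := by
    rintro ω ⟨h1, h2⟩
    obtain ⟨n, hn⟩ := exists_nat_one_div_lt h2
    exact Set.mem_iUnion.2 ⟨n, h1, hn⟩
  refine h.ne' (measure_mono_null hsub (measure_iUnion_null fun n => ?_))
  exact le_antisymm (hcon _ (by positivity)) zero_le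

omit [IsProbabilityMeasure P] in
/-- A nonnegative harmonic function of the killed walk which is positive far up is positive. -/
lemma IsHarmonicKilled.pos_of_pos_above {h : ℝ × ℝ → ℝ}
    (hharm : IsHarmonicKilled P X openQuadrant h)
    (hX : ∀ n, Measurable (X n)) (hquad : 0 < P {ω | X 0 ω ∈ openQuadrant})
    (hnn : ∀ x ∈ openQuadrant, 0 ≤ h x) {b : ℝ}
    (hb : ∀ x ∈ openQuadrant, b ≤ x.2 → 0 < h x) {x : ℝ × ℝ} (hx : x ∈ openQuadrant) : 0 < h x := by
  obtain ⟨κ, hκ, hP⟩ := exists_pos_measure_gt hquad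
  -- Induction on the number of upward steps of height κ needed to reach level b; each has positive
  -- probability and keeps the walk in the quadrant.
  have key : ∀ (j : ℕ) (y : ℝ × ℝ), y ∈ openQuadrant → b ≤ y.2 + j * κ → 0 < h y := by
    intro j
    induction j with
    | zero => exact fun y hy hby => hb y hy (by simpa using hby)
    | succ j ih =>
      intro y hy hby
      obtain ⟨hint, hval⟩ := hharm y hy
      have hset : {ω | 1 < exitTime X openQuadrant y ω} = survivalSet X openQuadrant y 1 := by
        ext ω
        rw [← lt_exitTime_iff]
        simp
      rw [hset] at hint hval
      have hm : MeasurableSet (survivalSet X openQuadrant y 1) :=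
        measurableSet_survivalSet hX measurableSet_openQuadrant
      have hnn' : 0 ≤ᵐ[P.restrict (survivalSet X openQuadrant y 1)]
          fun ω => h (walkFrom X y 1 ω) :=
        (ae_restrict_iff' hm).2 (Eventually.of_forall fun ω hω =>
          hnn _ (walkFrom_mem_of_survival hy hω))
      rw [hval, setIntegral_pos_iff_support_of_nonneg_ae hnn' hint]
      refine lt_of_lt_of_le hP (measure_mono ?_)
      rintro ω ⟨h1, h2⟩
      have hmem : walkFrom X y 1 ω ∈ openQuadrant := by
        rw [walkFrom_one]
        exact ⟨add_pos hy.1 h1, add_pos hy.2 (hκ.trans h2)⟩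
      have hsurv : ω ∈ survivalSet X openQuadrant y 1 :=
        mem_survivalSet_succ.2 ⟨by simp [survivalSet_zero], hmem⟩
      refine ⟨(ih _ hmem ?_).ne', hsurv⟩
      rw [walkFrom_one, Prod.snd_add]
      push_cast at hby
      linarith
  obtain ⟨j, hj⟩ := exists_nat_ge ((b - x.2) / κ)
  rw [div_le_iff₀ hκ] at hj
  exact key j x hx (by linarith)

end Quadrant

/-! ### Assembly -/

theorem proposition3p1 {Ω : Type*} [MeasurableSpace Ω] (P : Measure Ω) [IsProbabilityMeasure P]
    (X : ℕ → Ω → ℝ × ℝ) (hmeas : ∀ n, Measurable (X n))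
    (hindep : iIndepFun X P) (hident : ∀ n, IdentDistrib (X n) (X 0) P P)
    (hquad : 0 < P {ω | X 0 ω ∈ openQuadrant})
    (δ : ℝ) (hδ : 0 < δ)
    (hmom₁ : Integrable (fun ω => |(X 0 ω).1| ^ (2 + δ)) P)
    (hmom₂ : Integrable (fun ω => |(X 0 ω).2| ^ (2 + δ)) P)
    (hmean₁ : ∫ ω, (X 0 ω).1 ∂P = 0)
    (hmean₂ : 0 < ∫ ω, (X 0 ω).2 ∂P)
    (hneg₂ : Integrable (fun ω => (max (-(X 0 ω).2) 0) ^ (3 + δ)) P) :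
    -- the expectations that define the two functions are finite
    (∀ t : ℝ, 0 < t →
      IntegrableOn (exitPosition (fun n ω => (X n ω).1) (Set.Ioi 0) t)
        (exitEvent (fun n ω => (X n ω).1) (Set.Ioi 0) t) P) ∧
    (∀ x ∈ openQuadrant,
      IntegrableOn (fun ω => (exitPosition X openQuadrant x ω).1)
        (exitEvent X openQuadrant x) P) ∧
    -- strict positivity and harmonicity
    (∀ x ∈ openQuadrant, 0 < quadrantFun P X x) ∧
    IsHarmonicKilled P X openQuadrant (quadrantFun P X) ∧
    -- comparison with the one-dimensional function
    (∀ x ∈ openQuadrant, quadrantFun P X x ≤ halfLineFun P (fun n ω => (X n ω).1) x.1) ∧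
    (∀ ε : ℝ, 0 < ε → ∃ b : ℝ, 0 < b ∧ ∀ x₁ x₂ : ℝ, b ≤ x₂ → 0 < x₁ → x₁ ≤ x₂ ^ (2 + δ) →
      |quadrantFun P X (x₁, x₂) / halfLineFun P (fun n ω => (X n ω).1) x₁ - 1| < ε) := by
  have hle2 : (2 : ℝ≥0∞) ≤ ENNReal.ofReal (2 + δ) := by
    rw [show (2 : ℝ≥0∞) = ENNReal.ofReal 2 by simp]
    exact ENNReal.ofReal_le_ofReal (by linarith)
  have hmemLp : ∀ Z : Ω → ℝ, Measurable Z → Integrable (fun ω => |Z ω| ^ (2 + δ)) P →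
      MemLp Z 2 P := fun Z hZ h => by
    have h1 : MemLp (fun z : ℝ => z) (ENNReal.ofReal (2 + δ)) (P.map Z) := by
      refine memLp_id_of_integrable_rpow (by linarith) ?_
      rw [integrable_map_measure (by fun_prop (disch := linarith)) hZ.aemeasurable]
      exact h
    exact ((memLp_map_measure_iff (by fun_prop) hZ.aemeasurable).1 h1).mono_exponent hle2
  have hL1 := hmemLp _ (hmeas 0).fst hmom₁
  have hL2 := hmemLp _ (hmeas 0).snd hmom₂
  have hi : Integrable (fun ω => (X 0 ω).1) P := hL1.integrable (by norm_num)
  have hPpos : 0 < P {ω | 0 < (X 0 ω).1} := hquad.trans_le (measure_mono fun ω hω => hω.1)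
  have hpos : 0 < ∫ ω, max (X 0 ω).1 0 ∂P := by
    refine (integral_pos_iff_support_of_nonneg (fun ω => le_max_right _ _) hi.pos_part).2 ?_
    refine hPpos.trans_le (measure_mono fun ω (hω : 0 < (X 0 ω).1) => ?_)
    simp [hω]
  obtain ⟨V, C, hV⟩ : ∃ V C, IsSuperharmonicMajorant (P.map (X 0)) V C := by
    have hm := (hmeas 0).fst
    have : IsProbabilityMeasure (P.map fun ω => (X 0 ω).1) :=
      Measure.isProbabilityMeasure_map hm.aemeasurable
    obtain ⟨V, C, h1, h2, h3, h4, h5⟩ := exists_superharmonic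
      (ν := P.map fun ω => (X 0 ω).1) hδ
      (by rw [integrable_map_measure (by fun_prop (disch := linarith)) hm.aemeasurable]
          exact hmom₁)
      (by rw [integral_map hm.aemeasurable (by fun_prop)]; exact hmean₁)
      (by rw [Measure.map_apply hm measurableSet_Ioi]; exact hPpos)
    refine ⟨V, C, h1, h2, h3, h4, fun y hy => ?_⟩
    refine le_trans (le_of_eq ?_) (h5 y hy)
    have hVy : Measurable fun z : ℝ × ℝ => V (y + z.1) :=
      h2.comp (measurable_const.add measurable_fst)
    have hVy' : Measurable fun z => V (y + z) := h2.comp (measurable_const_add y)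
    rw [integral_map (hmeas 0).aemeasurable hVy.aestronglyMeasurable,
      integral_map hm.aemeasurable hVy'.aestronglyMeasurable]
  obtain ⟨K, hK⟩ := exists_measure_sum_nonpos_le (Y := fun n ω => (X n ω).2)
    (fun n => (hmeas n).snd) (hindep.comp (fun _ => Prod.snd) fun _ => measurable_snd)
    (fun n => (hident n).comp measurable_snd) hL2.integrable_sq (hL2.integrable (by norm_num))
    hmean₂ hδ hneg₂
  have hQpos : ∀ y ∈ openQuadrant, 0 < y.1 := fun y hy => hy.1
  have hHpos : ∀ y ∈ openHalfPlane, 0 < y.1 := fun y hy => hy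
  have hharm : IsHarmonicKilled P X openQuadrant (quadrantFun P X) :=
    isHarmonicKilled_domainFun hmeas hindep hident hi measurableSet_openQuadrant hQpos hmean₁ hV
  have hlim : ∀ ε : ℝ, 0 < ε → ∃ b : ℝ, 0 < b ∧ ∀ x : ℝ × ℝ, b ≤ x.2 → 0 < x.1 →
      |domainFun P X openQuadrant x / domainFun P X openHalfPlane x - 1| < ε := fun ε hε =>
    exists_abs_div_sub_one_lt hmeas hindep hident hL1 hmean₁ hpos hV hδ hK hε
  have hnn : ∀ x ∈ openQuadrant, 0 ≤ quadrantFun P X x := fun x hx =>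
    domainFun_nonneg hmeas hindep hident hi measurableSet_openQuadrant hQpos hmean₁ hV hx
  refine ⟨fun t ht => ?_, fun x hx => ?_, fun x hx => ?_, hharm, fun x hx => ?_, fun ε hε => ?_⟩
  · rw [exitEvent_fst t 0]
    simp only [funext (exitPosition_fst (X := X) t 0)]
    exact integrableOn_exitPosition_fst hmeas hindep hident hi measurableSet_openHalfPlane hHpos
      hV ht
  · exact integrableOn_exitPosition_fst hmeas hindep hident hi measurableSet_openQuadrant hQpos
      hV hx
  -- With ε = 1 the ratio cannot vanish, so h is positive above level b.
  · obtain ⟨b, -, hb⟩ := hlim 1 one_pos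
    refine hharm.pos_of_pos_above hmeas hquad hnn (b := b) (fun y hy hby => ?_) hx
    refine (hnn y hy).lt_of_ne fun h0 => ?_
    have h1 := hb y hby hy.1
    rw [show domainFun P X openQuadrant y = 0 from h0.symm] at h1
    norm_num at h1
  · rw [halfLineFun_fst x.1 x.2]
    exact domainFun_quadrant_le hmeas hindep hident hi hmean₁ hV hx
  · obtain ⟨b, hb0, hb⟩ := hlim ε hε
    refine ⟨b, hb0, fun x₁ x₂ hx2 hx1 _ => ?_⟩
    rw [halfLineFun_fst x₁ x₂]
    exact hb (x₁, x₂) hx2 hx1
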